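/- Notation: $\mathbb{N}=\{1,2,\dots\}$; $\|f\|_X=\sup_X|f|$; $\mathcal{P}(\mathbb{C}^N)$ is the space of complex polynomials in $N$ variables; a sequence $(u_n)_{n\in\mathbb{N}}$ has polynomial growth if $u_n=O(n^r)$ for some $r$. Weakly admissible meshes on a compact set $X\subset\mathbb{C}^N$ are finite sets $\mathcal{A}_n\subset X$, $n\in\mathbb{N}$, with $\mathrm{card}\,\mathcal{A}_n$ of polynomial growth, for which there are constants $C_n>0$ of polynomial growth such that $\|p\|_X\le C_n\|p\|_{\mathcal{A}_n}$ for all $n\in\mathbb N$ and all polynomials $p$ of degree at most $n$. A set $X$ is polynomially determining if every $p\in\mathcal{P}(\mathbb{C}^N)$ vanishing on $X$ is zero. A compact set $X$ satisfies the division inequality if there is $m>0$ such that for every polynomial $q\not\equiv0$ on $X$ there is $M>0$ with $\|p\|_X\le M(\deg p+\deg q)^{m\deg q}\|pq\|_X$ for all polynomials $p$ (with $0^0=1$). For a polynomial $s(z,y)$ that is monic in $y$, $\mathcal{A}(s)$ is the set of $z$ at which $\mathrm{Res}_y(s,\partial s/\partial y)$ vanishes. Theorem. Let $k_1,k_2\in\mathbb{N}$,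 and let \[ s_1(z,y_1)=y_1^{k_1}+\sum_{j=0}^{k_1-1}\tilde\varsigma_j(z)\,y_1^j,\qquad s_2(z,y_1,y_2)=y_2^{k_2}+\sum_{j=0}^{k_2-1}\tilde{\tilde\varsigma}_j(z,y_1)\,y_2^j \] with polynomials $\tilde\varsigma_j\in\mathcal{P}(\mathbb{C}^N)$, $\tilde{\tilde\varsigma}_j\in\mathcal{P}(\mathbb{C}^{N+1})$, and let $d_i=\deg s_i$ be the total degrees (so $d_i\ge k_i$). Assume that $s_1$ is irreducible. Let $K\subset\mathbb{C}^N$ be a compact set that has weakly admissible meshes $(\mathcal{A}_n)_{n\in\mathbb{N}}$, is polynomially determining and satisfies the division inequality. Put \[F=\{(z,y_1)\in\mathbb{C}^{N+1}: s_1(z,y_1)=0,\ z\in K\},\qquad E=\{(z,y_1,y_2)\in\mathbb{C}^{N+2}: s_1(z,y_1)=0,\ s_2(z,y_1,y_2)=0,\ z\in K\},\] and assume that $K\setminus\mathcal{A}(s_1)\ne\emptyset$ and $F\setminus\mathcal{A}(s_2)\neq\emptyset$. Then $E$ is compact and, for every $a\in K\setminus\mathcal{A}(s_1)$ and every $b\in\pi(F\setminus\mathcal{A}(s_2))$,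 where $\pi(z,y_1)=z$, the sets \[\mathcal{B}_n=\{(z,y_1,y_2)\in E: z\in\mathcal{A}_{l(n)}\cup\{a,b\}\},\qquad n\in\mathbb{N},\] are weakly admissible meshes on $E$, where \[l(n)=\begin{cases}4n+4(k_2^2-k_2)+2(k_1^2-k_1)&\text{if }d_1=k_1,\ d_2=k_2,\\ 4d_1n+4d_1(k_2^2-k_2)&\text{if }d_1>k_1,\ d_2=k_2,\\ 4d_2n+2(k_1^2-k_1)&\text{if }d_1=k_1,\ d_2>k_2,\\ 4d_1d_2n&\text{if }d_1>k_1,\ d_2>k_2.\end{cases}\] In particular, $\|P\|_E\le C(\mathcal{B}_n)\,\|P\|_{\mathcal{B}_n}$ for every $n\in\mathbb{N}$ and every polynomial $P$ on $\mathbb{C}^{N+2}$ of degree at most $n$, with $(C(\mathcal{B}_n))_n$ of polynomial growth in $n$. -/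

import Mathlib

noncomputable section

namespace PolyMesh

/-- The uniform norm `‖p‖_K = sup_{z ∈ K} |p(z)|` of a polynomial on a set `K ⊆ ℂ^N`
(used for nonempty compact or finite `K` only; it is `0` for empty `K`). -/
def polyNorm {N : ℕ} (K : Set (Fin N → ℂ)) (p : MvPolynomial (Fin N) ℂ) : ℝ :=
  sSup ((fun z => ‖MvPolynomial.eval z p‖) '' K)

/-- A real sequence indexed by `n ≥ 1` has polynomial growth: `u n = O(n ^ r)` for some `r`. -/
def PolynomialGrowth (u : ℕ → ℝ) : Prop :=
  ∃ r : ℕ, u =O[Filter.atTop] fun n : ℕ => (n : ℝ) ^ r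

/-- The sets `A n`, `n = 1, 2, …`, are weakly admissible meshes on (the compact set) `K`:
finite subsets of `K` whose cardinalities grow polynomially, such that
`‖p‖_K ≤ C_n ‖p‖_{A n}` for all polynomials `p` of degree at most `n`, with positive constants
`C_n` of polynomial growth. -/
structure IsWAM {N : ℕ} (K : Set (Fin N → ℂ)) (A : ℕ → Set (Fin N → ℂ)) : Prop where
  subset : ∀ n, 1 ≤ n → A n ⊆ K
  finite : ∀ n, 1 ≤ n → (A n).Finite
  norming : ∃ C : ℕ → ℝ, (∀ n, 1 ≤ n → 0 < C n) ∧ PolynomialGrowth C ∧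
    ∀ n, 1 ≤ n → ∀ p : MvPolynomial (Fin N) ℂ, p.totalDegree ≤ n →
      polyNorm K p ≤ C n * polyNorm (A n) p
  card_growth : PolynomialGrowth fun n => ((A n).ncard : ℝ)

/-- `K` is determining for all polynomials on `ℂ^N`: only the zero polynomial vanishes on `K`. -/
def IsPolyDetermining {N : ℕ} (K : Set (Fin N → ℂ)) : Prop :=
  ∀ p : MvPolynomial (Fin N) ℂ, (∀ z ∈ K, MvPolynomial.eval z p = 0) → p = 0

/-- The division (Schur-type) inequality with exponent `m`: for every polynomial `q` that is not
identically zero on `K` there is `M > 0` with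
`‖p‖_K ≤ M (deg p + deg q) ^ (m deg q) ‖p q‖_K` for all polynomials `p`. -/
def DivisionInequalityWith {N : ℕ} (K : Set (Fin N → ℂ)) (m : ℝ) : Prop :=
  ∀ q : MvPolynomial (Fin N) ℂ, (∃ z ∈ K, MvPolynomial.eval z q ≠ 0) →
    ∃ M : ℝ, 0 < M ∧ ∀ p : MvPolynomial (Fin N) ℂ,
      polyNorm K p ≤
        M * ((p.totalDegree : ℝ) + (q.totalDegree : ℝ)) ^ (m * (q.totalDegree : ℝ)) *
          polyNorm K (p * q)

/-- `K` satisfies the division inequality with some exponent `m > 0`. -/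
def SatisfiesDivisionInequality {N : ℕ} (K : Set (Fin N → ℂ)) : Prop :=
  ∃ m : ℝ, 0 < m ∧ DivisionInequalityWith K m

/-- The polynomial `s(z, y) = y ^ k + ∑_{j < k} ς_j(z) y ^ j` on `ℂ^(N+1)`; the variable `y` is the
last coordinate. -/
def monicForm {N k : ℕ} (ς : Fin k → MvPolynomial (Fin N) ℂ) : MvPolynomial (Fin (N + 1)) ℂ :=
  MvPolynomial.X (Fin.last N) ^ k +
    ∑ j : Fin k, MvPolynomial.rename Fin.castSucc (ς j) * MvPolynomial.X (Fin.last N) ^ (j : ℕ)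

/-- The same polynomial `y ^ k + ∑_{j < k} ς_j(z) y ^ j`, as a univariate polynomial in `y` whose
coefficients are polynomials in `z`. -/
def monicFormY {N k : ℕ} (ς : Fin k → MvPolynomial (Fin N) ℂ) :
    Polynomial (MvPolynomial (Fin N) ℂ) :=
  Polynomial.X ^ k + ∑ j : Fin k, Polynomial.C (ς j) * Polynomial.X ^ (j : ℕ)

/-- The two forms define the same function of `(z, y)`. -/
theorem eval_monicForm {N k : ℕ} (ς : Fin k → MvPolynomial (Fin N) ℂ) (x : Fin (N + 1) → ℂ) :
    MvPolynomial.eval x (monicForm ς) =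
      ((monicFormY ς).map (MvPolynomial.eval (Fin.init x))).eval (x (Fin.last N)) := by
  have h : x ∘ Fin.castSucc = Fin.init x := rfl
  simp [monicForm, monicFormY, Polynomial.eval_finsetSum, Polynomial.map_sum,
    MvPolynomial.eval_rename, h]

/-- The discriminant set `𝒜(s) = {z : Res_y(s, ∂s/∂y)(z) = 0}` of
`s = y ^ k + ∑_{j < k} ς_j(z) y ^ j`. -/
def discSet {N k : ℕ} (ς : Fin k → MvPolynomial (Fin N) ℂ) : Set (Fin N → ℂ) :=
  {z | MvPolynomial.eval z
    (Polynomial.resultant (monicFormY ς) (Polynomial.derivative (monicFormY ς))) = 0}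

/-- The set `{(z, y) ∈ V(s) : z ∈ K}` in `ℂ^(N+1)`, for a polynomial `s` in `(z, y)`. -/
def liftOver {N : ℕ} (s : MvPolynomial (Fin (N + 1)) ℂ) (K : Set (Fin N → ℂ)) :
    Set (Fin (N + 1) → ℂ) :=
  {x | MvPolynomial.eval x s = 0 ∧ Fin.init x ∈ K}

/-- The set `{(z, y₁, y₂) ∈ V(s₁, s₂) : z ∈ K}` in `ℂ^(N+2)`, for polynomials `s₁` in `(z, y₁)`
and `s₂` in `(z, y₁, y₂)`. -/
def liftOver₂ {N : ℕ} (s₁ : MvPolynomial (Fin (N + 1)) ℂ) (s₂ : MvPolynomial (Fin (N + 2)) ℂ)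
    (K : Set (Fin N → ℂ)) : Set (Fin (N + 2) → ℂ) :=
  {x | MvPolynomial.eval (Fin.init x) s₁ = 0 ∧ MvPolynomial.eval x s₂ = 0 ∧
    Fin.init (Fin.init x) ∈ K}

/-- The index `l(n)` (each `d_i ≥ k_i`, so `d_i ≠ k_i` means `d_i > k_i`). -/
def meshIndex (d₁ k₁ d₂ k₂ n : ℕ) : ℕ :=
  if d₁ = k₁ then
    if d₂ = k₂ then 4 * n + 4 * (k₂ ^ 2 - k₂) + 2 * (k₁ ^ 2 - k₁)
    else 4 * d₂ * n + 2 * (k₁ ^ 2 - k₁)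
  else
    if d₂ = k₂ then 4 * d₁ * n + 4 * d₁ * (k₂ ^ 2 - k₂)
    else 4 * d₁ * d₂ * n

end PolyMesh

end

namespace PolyMesh

/-! `E` is a tower of two monic covers over `K`, and the estimate is reduced to polynomials on `K`.
Reduction modulo `s₂`, then modulo `s₁`, writes `P` on `E` as a sum of terms `c_{ji}(z) y₁^i y₂^j`
with `deg c_{ji} ≤ w₁ w₂ n`, where `w = 1` if `d = k` and `w = d` otherwise. Lagrange interpolation
in a fibre recovers the coefficients from the values, with the discriminant as only denominator. The
discriminant of `s₂` still contains `y₁`; since `s₁` is irreducible, some multiple of it agrees on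
`s₁ = 0` with a nonzero polynomial in `z` alone (`exists_eliminant`). Hence there is one `D(z) ≠ 0`
such that every `c_{ji} D` is bounded at mesh points by the values of `P` above them
(`exists_multiplier_bound`). The mesh inequality carries this bound to `K`, the division inequality
removes `D` at a polynomial cost in `n`, and the roots `y₁, y₂` are bounded
(`exists_polyNorm_liftOver_le`).

This needs `w₁ w₂ n + deg D ≤ l(n)`, which holds once `n ≥ deg D`. For the finitely many smaller `n`
any finite constant will do, and by finite dimension it suffices that polynomials of degree at most
`n` vanishing on `ℬ_n` vanish on `E` (`Determines.liftOver_liftOver`). Vanishing is lifted one level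
at a time: through the discriminant if `d = k`, whose degree bound `k² - k` explains the additive
terms of `l(n)`, and through the fibre norm, of degree at most `d n`, if `d > k`. -/

/-! ### Polynomials in the last variable -/

/-- Polynomials in `M + 1` variables as univariate polynomials in the last variable. -/
noncomputable def lastEquiv (M : ℕ) :
    MvPolynomial (Fin (M + 1)) ℂ ≃ₐ[ℂ] Polynomial (MvPolynomial (Fin M) ℂ) :=
  (MvPolynomial.renameEquiv ℂ (finRotate (M + 1))).trans (MvPolynomial.finSuccEquiv ℂ M)

theorem lastEquiv_X_last (M : ℕ) :
    lastEquiv M (MvPolynomial.X (Fin.last M)) = Polynomial.X := by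
  simp [lastEquiv, MvPolynomial.finSuccEquiv_X_zero]

theorem lastEquiv_X_castSucc {M : ℕ} (i : Fin M) :
    lastEquiv M (MvPolynomial.X i.castSucc) = Polynomial.C (MvPolynomial.X i) := by
  have h : finRotate (M + 1) i.castSucc = i.succ := by simp
  simp only [lastEquiv, AlgEquiv.trans_apply, MvPolynomial.renameEquiv_apply,
    MvPolynomial.rename_X, h, MvPolynomial.finSuccEquiv_X_succ]

theorem lastEquiv_rename_castSucc {M : ℕ} (p : MvPolynomial (Fin M) ℂ) :
    lastEquiv M (MvPolynomial.rename Fin.castSucc p) = Polynomial.C p := by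
  induction p using MvPolynomial.induction_on with
  | C a =>
    rw [MvPolynomial.rename_C]
    exact (lastEquiv M).commutes a
  | add p q hp hq => simp [hp, hq]
  | mul_X p i hp => simp [hp, lastEquiv_X_castSucc]

theorem lastEquiv_C {M : ℕ} (c : ℂ) :
    lastEquiv M (MvPolynomial.C c) = Polynomial.C (MvPolynomial.C c) :=
  (lastEquiv M).commutes c

theorem lastEquiv_monicForm {M k : ℕ} (ς : Fin k → MvPolynomial (Fin M) ℂ) :
    lastEquiv M (monicForm ς) = monicFormY ς := by
  simp [monicForm, monicFormY, lastEquiv_X_last, lastEquiv_rename_castSucc]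

theorem eval_eq_eval_lastEquiv {M : ℕ} (P : MvPolynomial (Fin (M + 1)) ℂ)
    (x : Fin (M + 1) → ℂ) :
    MvPolynomial.eval x P =
      ((lastEquiv M P).map (MvPolynomial.eval (Fin.init x))).eval (x (Fin.last M)) := by
  induction P using MvPolynomial.induction_on with
  | C a => simp [lastEquiv_C]
  | add p q hp hq => simp [hp, hq]
  | mul_X p i hp =>
    simp only [map_mul, hp, Polynomial.map_mul, Polynomial.eval_mul, MvPolynomial.eval_X]
    congr 1
    refine Fin.lastCases ?_ (fun j => ?_) i
    · simp [lastEquiv_X_last]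
    · simp [lastEquiv_X_castSucc, Fin.init]

theorem totalDegree_coeff_lastEquiv_add_le {M : ℕ} (P : MvPolynomial (Fin (M + 1)) ℂ) (i : ℕ)
    (h : (lastEquiv M P).coeff i ≠ 0) :
    ((lastEquiv M P).coeff i).totalDegree + i ≤ P.totalDegree := by
  have e : lastEquiv M P =
      MvPolynomial.finSuccEquiv ℂ M (MvPolynomial.rename (finRotate (M + 1)) P) := by
    rw [lastEquiv, AlgEquiv.trans_apply, MvPolynomial.renameEquiv_apply]
  rw [e] at h ⊢
  exact (MvPolynomial.totalDegree_coeff_finSuccEquiv_add_le _ i h).trans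
    (MvPolynomial.totalDegree_rename_le _ _)

theorem natDegree_lastEquiv_le {M : ℕ} (P : MvPolynomial (Fin (M + 1)) ℂ) :
    (lastEquiv M P).natDegree ≤ P.totalDegree := by
  by_cases h : lastEquiv M P = 0
  · simp [h]
  · have := totalDegree_coeff_lastEquiv_add_le P (lastEquiv M P).natDegree (by simpa using h)
    omega

/-! ### The monic polynomial -/

section Monic

variable {M k : ℕ} (ς : Fin k → MvPolynomial (Fin M) ℂ)

theorem monic_monicFormY : (monicFormY ς).Monic :=
  Polynomial.monic_X_pow_add (Polynomial.degree_sum_fin_lt ς)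

theorem natDegree_monicFormY : (monicFormY ς).natDegree = k := by
  have h : (monicFormY ς).degree = k := by
    rw [monicFormY, Polynomial.degree_add_eq_left_of_degree_lt, Polynomial.degree_X_pow]
    rw [Polynomial.degree_X_pow]
    exact Polynomial.degree_sum_fin_lt ς
  exact Polynomial.natDegree_eq_of_degree_eq_some h

theorem coeff_monicFormY (j : Fin k) : (monicFormY ς).coeff j = ς j := by
  have hj : (j : ℕ) ≠ k := j.2.ne
  simp [monicFormY, Polynomial.coeff_X_pow, hj, Fin.val_inj]

/-- The univariate polynomial `s(z, ·)`. -/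
noncomputable def fibrePoly (z : Fin M → ℂ) : Polynomial ℂ :=
  (monicFormY ς).map (MvPolynomial.eval z)

theorem monic_fibrePoly (z : Fin M → ℂ) : (fibrePoly ς z).Monic :=
  (monic_monicFormY ς).map _

theorem natDegree_fibrePoly (z : Fin M → ℂ) : (fibrePoly ς z).natDegree = k := by
  rw [fibrePoly, (monic_monicFormY ς).natDegree_map, natDegree_monicFormY]

theorem eval_fibrePoly (z : Fin M → ℂ) (y : ℂ) :
    (fibrePoly ς z).eval y = y ^ k + ∑ j : Fin k, MvPolynomial.eval z (ς j) * y ^ (j : ℕ) := by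
  simp [fibrePoly, monicFormY, Polynomial.eval_finsetSum, Polynomial.map_sum]

theorem eval_monicForm_eq_eval_fibrePoly (x : Fin (M + 1) → ℂ) :
    MvPolynomial.eval x (monicForm ς) = (fibrePoly ς (Fin.init x)).eval (x (Fin.last M)) :=
  eval_monicForm ς x

theorem mem_liftOver_iff {K : Set (Fin M → ℂ)} {x : Fin (M + 1) → ℂ} :
    x ∈ liftOver (monicForm ς) K ↔
      (fibrePoly ς (Fin.init x)).eval (x (Fin.last M)) = 0 ∧ Fin.init x ∈ K := by
  rw [liftOver, Set.mem_ofPred_eq, eval_monicForm_eq_eval_fibrePoly]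

theorem snoc_mem_liftOver_iff {K : Set (Fin M → ℂ)} {z : Fin M → ℂ} {y : ℂ} :
    (Fin.snoc z y : Fin (M + 1) → ℂ) ∈ liftOver (monicForm ς) K ↔
      (fibrePoly ς z).eval y = 0 ∧ z ∈ K := by
  simp [mem_liftOver_iff, Fin.init_snoc, Fin.snoc_last]

theorem le_totalDegree_monicForm : k ≤ (monicForm ς).totalDegree := by
  have h := natDegree_lastEquiv_le (monicForm ς)
  rwa [lastEquiv_monicForm, natDegree_monicFormY] at h

theorem totalDegree_coeff_monicFormY_add_le (i : ℕ) (h : (monicFormY ς).coeff i ≠ 0) :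
    ((monicFormY ς).coeff i).totalDegree + i ≤ (monicForm ς).totalDegree := by
  have := totalDegree_coeff_lastEquiv_add_le (monicForm ς) i
  rw [lastEquiv_monicForm] at this
  exact this h

/-- The weight of the variable `y` with respect to reduction modulo `s`. -/
def weight (d k : ℕ) : ℕ := if d = k then 1 else d

/-- With `y` given this weight, replacing `y ^ k` by lower terms does not raise the weighted degree.
If `d = k` this is `deg ς_j + j ≤ d`; otherwise `deg ς_j ≤ d` suffices because `k - j ≥ 1`. -/
theorem totalDegree_le_weight_mul (j : Fin k) :
    (ς j).totalDegree ≤ weight (monicForm ς).totalDegree k * (k - j) := by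
  by_cases h : ς j = 0
  · simp [h]
  have h1 := totalDegree_coeff_monicFormY_add_le ς j (by rwa [coeff_monicFormY])
  rw [coeff_monicFormY] at h1
  have h2 := j.2
  unfold weight
  split_ifs with hd
  · omega
  · calc (ς j).totalDegree ≤ (monicForm ς).totalDegree * 1 := by omega
      _ ≤ _ := Nat.mul_le_mul_left _ (by omega)

theorem one_le_weight (hk : 1 ≤ k) : 1 ≤ weight (monicForm ς).totalDegree k := by
  have := le_totalDegree_monicForm ς
  unfold weight
  split_ifs <;> omega

theorem norm_le_of_eval_fibrePoly_eq_zero {z : Fin M → ℂ} {y : ℂ}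
    (h : (fibrePoly ς z).eval y = 0) :
    ‖y‖ ≤ 1 + ∑ j : Fin k, ‖MvPolynomial.eval z (ς j)‖ := by
  by_contra! hlt
  have hS : 0 ≤ ∑ j : Fin k, ‖MvPolynomial.eval z (ς j)‖ :=
    Finset.sum_nonneg fun _ _ => norm_nonneg _
  have hy : 1 ≤ ‖y‖ := by linarith
  rw [eval_fibrePoly] at h
  rcases Nat.eq_zero_or_pos k with rfl | hk
  · simp at h
  have h1 : y ^ k = -∑ j : Fin k, MvPolynomial.eval z (ς j) * y ^ (j : ℕ) :=
    eq_neg_of_add_eq_zero_left h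
  have h2 : ‖y‖ ^ k ≤ (∑ j : Fin k, ‖MvPolynomial.eval z (ς j)‖) * ‖y‖ ^ (k - 1) := by
    rw [← norm_pow, h1, norm_neg, Finset.sum_mul]
    refine (norm_sum_le _ _).trans (Finset.sum_le_sum fun j _ => ?_)
    rw [norm_mul, norm_pow]
    have := j.2
    have hj : (j : ℕ) ≤ k - 1 := by omega
    exact mul_le_mul_of_nonneg_left (pow_le_pow_right₀ hy hj) (norm_nonneg _)
  have h3 : ‖y‖ ^ k = ‖y‖ * ‖y‖ ^ (k - 1) := by
    rw [← pow_succ', Nat.sub_add_cancel hk]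
  rw [h3] at h2
  have h4 : ‖y‖ ≤ ∑ j : Fin k, ‖MvPolynomial.eval z (ς j)‖ :=
    le_of_mul_le_mul_right h2 (by positivity)
  linarith

theorem exists_norm_le_of_eval_fibrePoly_eq_zero {X : Set (Fin M → ℂ)} (hX : IsCompact X) :
    ∃ R : ℝ, 1 ≤ R ∧ ∀ z ∈ X, ∀ y, (fibrePoly ς z).eval y = 0 → ‖y‖ ≤ R := by
  have hc : Continuous fun z : Fin M → ℂ => 1 + ∑ j : Fin k, ‖MvPolynomial.eval z (ς j)‖ := by
    have := fun j => MvPolynomial.continuous_eval (ς j)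
    fun_prop
  obtain ⟨R, hR⟩ := hX.bddAbove_image hc.continuousOn
  refine ⟨max 1 R, le_max_left _ _, fun z hz y hy => ?_⟩
  exact (norm_le_of_eval_fibrePoly_eq_zero ς hy).trans
    ((hR (Set.mem_image_of_mem _ hz)).trans (le_max_right _ _))

theorem isCompact_liftOver {X : Set (Fin M → ℂ)} (hX : IsCompact X) :
    IsCompact (liftOver (monicForm ς) X) := by
  obtain ⟨R, hR1, hR⟩ := exists_norm_le_of_eval_fibrePoly_eq_zero ς hX
  have hinit : Continuous fun x : Fin (M + 1) → ℂ => (Fin.init x : Fin M → ℂ) :=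
    continuous_pi fun i => continuous_apply _
  have hcl : IsClosed (liftOver (monicForm ς) X) :=
    (isClosed_singleton.preimage (MvPolynomial.continuous_eval (monicForm ς))).inter
      (hX.isClosed.preimage hinit)
  -- Since the roots are bounded over `X`, the closed set in question lies in a copy of `X` times a
  -- disc.
  have himg : IsCompact ((fun q : (Fin M → ℂ) × ℂ => (Fin.snoc q.1 q.2 : Fin (M + 1) → ℂ)) ''
      (X ×ˢ Metric.closedBall 0 R)) := by
    refine (hX.prod (isCompact_closedBall 0 R)).image ?_
    refine continuous_pi fun i => ?_
    refine Fin.lastCases ?_ (fun j => ?_) i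
    · simpa using continuous_snd
    · simp only [Fin.snoc_castSucc]
      exact (continuous_apply j).comp continuous_fst
  refine himg.of_isClosed_subset hcl fun x hx => ?_
  rw [mem_liftOver_iff] at hx
  exact ⟨(Fin.init x, x (Fin.last M)), ⟨hx.2, by simpa using hR _ hx.2 _ hx.1⟩,
    Fin.snoc_init_self x⟩

theorem finite_liftOver {X : Set (Fin M → ℂ)} (hX : X.Finite) :
    (liftOver (monicForm ς) X).Finite ∧ (liftOver (monicForm ς) X).ncard ≤ X.ncard * k := by
  classical
  let T : Finset (Fin (M + 1) → ℂ) := hX.toFinset.biUnion fun z =>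
    (fibrePoly ς z).roots.toFinset.image fun y => Fin.snoc z y
  have hT : liftOver (monicForm ς) X ⊆ T := fun x hx => by
    rw [mem_liftOver_iff] at hx
    simp only [T, Finset.coe_biUnion, Set.mem_iUnion, Finset.coe_image, Set.mem_image]
    exact ⟨Fin.init x, by simpa using hx.2, x (Fin.last M),
      by simpa [(monic_fibrePoly ς _).ne_zero] using hx.1, Fin.snoc_init_self x⟩
  refine ⟨T.finite_toSet.subset hT, (Set.ncard_le_ncard hT T.finite_toSet).trans ?_⟩
  rw [Set.ncard_coe_finset, Set.ncard_eq_toFinset_card X hX]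
  refine Finset.card_biUnion_le_card_mul _ _ _ fun z _ => Finset.card_image_le.trans ?_
  refine (Multiset.toFinset_card_le _).trans ((Polynomial.card_roots' _).trans ?_)
  rw [natDegree_fibrePoly]

end Monic

/-! ### Degrees of determinants and resultants -/

/-- Each nonzero term of the Leibniz expansion picks one entry per row and column, so its degree is
at most the column weights minus the row weights. -/
theorem totalDegree_det_add_sum_le {ι σ : Type*} [Fintype ι] [DecidableEq ι]
    (A : Matrix ι ι (MvPolynomial σ ℂ)) (r c : ι → ℕ)
    (h : ∀ i j, A i j ≠ 0 → (A i j).totalDegree + r i ≤ c j) (hA : A.det ≠ 0) :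
    A.det.totalDegree + ∑ i, r i ≤ ∑ j, c j := by
  have key : ∀ τ : Equiv.Perm ι, (∏ i, A (τ i) i) ≠ 0 →
      (∏ i, A (τ i) i).totalDegree + ∑ i, r i ≤ ∑ j, c j := fun τ hτ => by
    rw [← Equiv.sum_comp τ r]
    refine (Nat.add_le_add_right (MvPolynomial.totalDegree_finsetProd _ _) _).trans ?_
    rw [← Finset.sum_add_distrib]
    refine Finset.sum_le_sum fun i _ => h _ _ fun h0 => hτ ?_
    exact Finset.prod_eq_zero (Finset.mem_univ i) h0
  obtain ⟨τ, -, hτ⟩ : ∃ τ ∈ Finset.univ,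
      (Equiv.Perm.sign τ • ∏ i, A (τ i) i : MvPolynomial σ ℂ) ≠ 0 :=
    Finset.exists_ne_zero_of_sum_ne_zero (by rwa [← Matrix.det_apply])
  -- Protects the truncated subtraction below; a nonzero determinant supplies the nonzero term
  -- needed.
  have hle : ∑ i, r i ≤ ∑ j, c j := by
    have := key τ fun h0 => hτ (by rw [h0, smul_zero])
    omega
  have hdet : A.det.totalDegree ≤ ∑ j, c j - ∑ i, r i := by
    rw [Matrix.det_apply]
    refine MvPolynomial.totalDegree_finsetSum_le fun τ _ => ?_
    have hs : (Equiv.Perm.sign τ • ∏ i, A (τ i) i : MvPolynomial σ ℂ).totalDegree ≤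
        (∏ i, A (τ i) i).totalDegree := by
      rcases Int.units_eq_one_or (Equiv.Perm.sign τ) with h1 | h1 <;> rw [h1] <;>
        simp [Units.smul_def]
    refine hs.trans ?_
    by_cases h0 : ∏ i, A (τ i) i = 0
    · simp [h0]
    · have := key τ h0
      omega
  omega

theorem totalDegree_resultant_le {σ : Type*} (f g : Polynomial (MvPolynomial σ ℂ))
    (m n d e : ℕ) (hm : m ≤ d)
    (hf : ∀ i, f.coeff i ≠ 0 → (f.coeff i).totalDegree + i ≤ d)
    (hg : ∀ i, g.coeff i ≠ 0 → (g.coeff i).totalDegree + i ≤ e) :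
    (f.resultant g m n).totalDegree + m * n ≤ d * n + e * m := by
  by_cases h0 : f.resultant g m n = 0
  · rw [h0, MvPolynomial.totalDegree_zero, zero_add]
    exact (Nat.mul_le_mul_right n hm).trans (Nat.le_add_right _ _)
  -- The entry in row `i` of a column shifted by `j` is a coefficient of index `i - j`, so its
  -- degree plus `i` is at most `e + j` or `d + j`.
  have key := totalDegree_det_add_sum_le (Polynomial.sylvester f g m n) (fun i => (i : ℕ))
    (Fin.addCases (fun j => e + (j : ℕ)) (fun j => d + (j : ℕ))) ?_ h0
  · change (f.resultant g m n).totalDegree + _ ≤ _ at key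
    rw [Fin.sum_univ_add, Fin.sum_univ_add] at key
    simp only [Fin.addCases_left, Fin.addCases_right, Fin.val_castAdd, Fin.val_natAdd,
      Finset.sum_add_distrib, Finset.sum_const, Finset.card_univ, Fintype.card_fin,
      smul_eq_mul] at key
    nlinarith
  · intro i j
    refine Fin.addCases (fun j => ?_) (fun j => ?_) j
    · simp only [Polynomial.sylvester, Matrix.of_apply, Fin.addCases_left, Set.mem_Icc]
      split_ifs with hij
      · intro h
        have := hg _ h
        omega
      · exact fun h => absurd rfl h
    · simp only [Polynomial.sylvester, Matrix.of_apply, Fin.addCases_right, Set.mem_Icc]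
      split_ifs with hij
      · intro h
        have := hf _ h
        omega
      · exact fun h => absurd rfl h

/-! ### Discriminant, fibre norm, and lifting of determining sets by the norm -/

section Monic

variable {M k : ℕ} (ς : Fin k → MvPolynomial (Fin M) ℂ)

/-- The resultant `Res_y(s, ∂s/∂y)`. -/
noncomputable def discPoly : MvPolynomial (Fin M) ℂ :=
  Polynomial.resultant (monicFormY ς) (Polynomial.derivative (monicFormY ς))

theorem notMem_discSet_iff {z : Fin M → ℂ} :
    z ∉ discSet ς ↔ MvPolynomial.eval z (discPoly ς) ≠ 0 := Iff.rfl

theorem natDegree_derivative_monicFormY :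
    (Polynomial.derivative (monicFormY ς)).natDegree = k - 1 := by
  rw [Polynomial.natDegree_derivative, natDegree_monicFormY]

theorem eval_discPoly (z : Fin M → ℂ) :
    MvPolynomial.eval z (discPoly ς) =
      Polynomial.resultant (fibrePoly ς z) (Polynomial.derivative (fibrePoly ς z))
        (fibrePoly ς z).natDegree ((fibrePoly ς z).natDegree - 1) := by
  rw [natDegree_fibrePoly, fibrePoly, Polynomial.derivative_map, Polynomial.resultant_map_map,
    discPoly, natDegree_monicFormY, natDegree_derivative_monicFormY]

theorem totalDegree_discPoly_le (hk : 1 ≤ k) (hd : (monicForm ς).totalDegree = k) :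
    (discPoly ς).totalDegree ≤ k ^ 2 - k := by
  have hs : ∀ i, (monicFormY ς).coeff i ≠ 0 → ((monicFormY ς).coeff i).totalDegree + i ≤ k := by
    intro i hi
    exact (totalDegree_coeff_monicFormY_add_le ς i hi).trans hd.le
  have h := totalDegree_resultant_le (monicFormY ς) (Polynomial.derivative (monicFormY ς))
    k (k - 1) k (k - 1) le_rfl hs ?_
  · rw [discPoly, natDegree_monicFormY, natDegree_derivative_monicFormY]
    have h2 : k ^ 2 - k = (k - 1) * k := by
      rw [pow_two, Nat.sub_mul, one_mul]
    omega
  · intro i hi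
    rw [Polynomial.coeff_derivative] at hi ⊢
    have h1 := hs (i + 1) (left_ne_zero_of_mul hi)
    have h2 : (((i : MvPolynomial (Fin M) ℂ) + 1)).totalDegree = 0 := by
      have : ((i : MvPolynomial (Fin M) ℂ) + 1) = MvPolynomial.C ((i : ℂ) + 1) := by simp
      rw [this, MvPolynomial.totalDegree_C]
    have h3 := MvPolynomial.totalDegree_mul ((monicFormY ς).coeff (i + 1))
      ((i : MvPolynomial (Fin M) ℂ) + 1)
    omega

/-- `Res_y(s, P)`, the product of the values of `P` on the fibre. -/
noncomputable def fibreNorm (n : ℕ) (P : MvPolynomial (Fin (M + 1)) ℂ) :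
    MvPolynomial (Fin M) ℂ :=
  Polynomial.resultant (monicFormY ς) (lastEquiv M P) k n

theorem totalDegree_fibreNorm_le {n : ℕ} {P : MvPolynomial (Fin (M + 1)) ℂ}
    (hP : P.totalDegree ≤ n) :
    (fibreNorm ς n P).totalDegree ≤ (monicForm ς).totalDegree * n := by
  have h := totalDegree_resultant_le (monicFormY ς) (lastEquiv M P) k n
    (monicForm ς).totalDegree n (le_totalDegree_monicForm ς)
    (totalDegree_coeff_monicFormY_add_le ς)
    (fun i hi => (totalDegree_coeff_lastEquiv_add_le P i hi).trans hP)
  have h2 : n * k = k * n := mul_comm n k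
  rw [fibreNorm]
  omega

theorem eval_fibreNorm {n : ℕ} {P : MvPolynomial (Fin (M + 1)) ℂ} (hP : P.totalDegree ≤ n)
    (z : Fin M → ℂ) :
    MvPolynomial.eval z (fibreNorm ς n P) =
      ((fibrePoly ς z).roots.map
        fun y => MvPolynomial.eval (Fin.snoc z y : Fin (M + 1) → ℂ) P).prod := by
  rw [fibreNorm, ← Polynomial.resultant_map_map]
  have h := Polynomial.resultant_eq_prod_eval (fibrePoly ς z)
    ((lastEquiv M P).map (MvPolynomial.eval z)) n
    (Polynomial.natDegree_map_le.trans ((natDegree_lastEquiv_le P).trans hP))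
    (IsAlgClosed.splits _)
  rw [natDegree_fibrePoly, (monic_fibrePoly ς z).leadingCoeff, one_pow, one_mul] at h
  rw [← fibrePoly, h]
  congr 1
  refine Multiset.map_congr rfl fun y _ => ?_
  rw [eval_eq_eval_lastEquiv, Fin.init_snoc, Fin.snoc_last]

/-- Polynomials of degree at most `l` that vanish on `A` vanish on `K`. -/
def Determines {M : ℕ} (A K : Set (Fin M → ℂ)) (l : ℕ) : Prop :=
  ∀ p : MvPolynomial (Fin M) ℂ, p.totalDegree ≤ l → (∀ z ∈ A, MvPolynomial.eval z p = 0) →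
    ∀ z ∈ K, MvPolynomial.eval z p = 0

/-- Let `c` be the value of `P` at the point `x`. The fibre norm of `P - c` equals `(-c) ^ k` over
`A`, hence over `K`; but over the base point of `x` one factor is zero, so `c = 0`. -/
theorem Determines.liftOver_of_totalDegree_mul_le {A K : Set (Fin M → ℂ)} {l n : ℕ}
    (h : Determines A K l) (hl : (monicForm ς).totalDegree * n ≤ l) :
    Determines (liftOver (monicForm ς) A) (liftOver (monicForm ς) K) n := by
  intro P hP hPA x hx
  rw [mem_liftOver_iff] at hx
  by_contra hne
  set c := MvPolynomial.eval x P with hc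
  have hQ : (P - MvPolynomial.C c).totalDegree ≤ n :=
    (MvPolynomial.totalDegree_sub_C_le _ _).trans hP
  have hR : ∀ z ∈ K,
      MvPolynomial.eval z (fibreNorm ς n (P - MvPolynomial.C c) - MvPolynomial.C ((-c) ^ k)) = 0 := by
    refine h _ ((MvPolynomial.totalDegree_sub_C_le _ _).trans
      ((totalDegree_fibreNorm_le ς hQ).trans hl)) fun z hz => ?_
    rw [map_sub, eval_fibreNorm ς hQ, MvPolynomial.eval_C, sub_eq_zero]
    have : (fibrePoly ς z).roots.map (fun y => MvPolynomial.eval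
        (Fin.snoc z y : Fin (M + 1) → ℂ) (P - MvPolynomial.C c)) =
        (fibrePoly ς z).roots.map (fun _ => -c) := by
      refine Multiset.map_congr rfl fun y hy => ?_
      rw [map_sub, MvPolynomial.eval_C, hPA _ ((snoc_mem_liftOver_iff ς).2
        ⟨(Polynomial.mem_roots'.1 hy).2, hz⟩), zero_sub]
    rw [this, Multiset.map_const', Multiset.prod_replicate,
      ← (IsAlgClosed.splits (fibrePoly ς z)).natDegree_eq_card_roots, natDegree_fibrePoly]
  have h1 := hR _ hx.2
  rw [map_sub, eval_fibreNorm ς hQ, MvPolynomial.eval_C, sub_eq_zero] at h1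
  have h2 : (0 : ℂ) ∈ (fibrePoly ς (Fin.init x)).roots.map (fun y => MvPolynomial.eval
        (Fin.snoc (Fin.init x) y : Fin (M + 1) → ℂ) (P - MvPolynomial.C c)) := by
    refine Multiset.mem_map.2 ⟨x (Fin.last M), ?_, ?_⟩
    · exact (Polynomial.mem_roots (monic_fibrePoly ς _).ne_zero).2 hx.1
    · rw [Fin.snoc_init_self, map_sub, MvPolynomial.eval_C, ← hc, sub_self]
  rw [Multiset.prod_eq_zero h2] at h1
  exact pow_ne_zero k (neg_ne_zero.2 hne) h1.symm

end Monic

/-! ### Lagrange interpolation in the fibres -/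

/-- The Lagrange formula for `g` at the roots of `f` has denominators `f'(y)`. Their product is the
resultant, so multiplying by it leaves only factors bounded in terms of `R`. -/
theorem norm_resultant_derivative_mul_coeff_le {f g : Polynomial ℂ} (hf : f.Monic) {R B : ℝ}
    (hR : 1 ≤ R) (hfR : ∀ y, f.eval y = 0 → ‖y‖ ≤ R) (hg : g.degree < f.natDegree)
    (hB : 0 ≤ B) (hgB : ∀ y, f.eval y = 0 → ‖g.eval y‖ ≤ B) (j : ℕ) :
    ‖f.resultant (Polynomial.derivative f) f.natDegree (f.natDegree - 1)‖ * ‖g.coeff j‖ ≤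
      f.natDegree * (((2 * R) ^ f.natDegree) ^ f.natDegree *
        (R ^ f.natDegree * f.natDegree.choose (f.natDegree / 2))) * B := by
  classical
  set D := f.resultant (Polynomial.derivative f) f.natDegree (f.natDegree - 1) with hD
  have hdef : D = (f.roots.map (Polynomial.derivative f).eval).prod := by
    rw [hD, Polynomial.resultant_eq_prod_eval _ _ _ (Polynomial.natDegree_derivative_le f)
      (IsAlgClosed.splits f), hf.leadingCoeff, one_pow, one_mul]
  by_cases h0 : D = 0
  · rw [h0, norm_zero, zero_mul]
    positivity
  have hroot : ∀ y, y ∈ f.roots ↔ f.eval y = 0 := fun y => Polynomial.mem_roots hf.ne_zero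
  -- A multiple root is also a root of `f'`, which would make the resultant vanish.
  have hnd : f.roots.Nodup := by
    rw [Multiset.nodup_iff_count_le_one]
    intro y
    by_contra! hlt
    rw [Polynomial.count_roots, Polynomial.one_lt_rootMultiplicity_iff_isRoot hf.ne_zero] at hlt
    refine h0 (hdef.trans (Multiset.prod_eq_zero (Multiset.mem_map.2 ⟨y, ?_, hlt.2⟩)))
    exact (hroot y).2 hlt.1
  set S : Finset ℂ := f.roots.toFinset with hS
  have hmem : ∀ y, y ∈ S ↔ f.eval y = 0 := fun y => by rw [hS, Multiset.mem_toFinset, hroot]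
  have hcard : S.card = f.natDegree := by
    rw [hS, Multiset.toFinset_card_of_nodup hnd,
      (IsAlgClosed.splits f).natDegree_eq_card_roots]
  have hDS : D = ∏ y ∈ S, (Polynomial.derivative f).eval y := by
    rw [hdef, Finset.prod, hS, Multiset.toFinset_val, hnd.dedup]
  have hnodal : f = Lagrange.nodal S id := by
    conv_lhs => rw [(IsAlgClosed.splits f).eq_prod_roots_of_monic hf]
    rw [Lagrange.nodal_eq, Finset.prod, hS, Multiset.toFinset_val, hnd.dedup]
    rfl
  have hder : ∀ y ∈ S, (Polynomial.derivative f).eval y = (Lagrange.nodal (S.erase y) id).eval y :=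
    fun y hy => by
      have := Lagrange.eval_nodal_derivative_eval_node_eq (v := (id : ℂ → ℂ)) hy
      rw [← hnodal] at this
      exact this
  have hder_le : ∀ y ∈ S, ‖(Polynomial.derivative f).eval y‖ ≤ (2 * R) ^ f.natDegree := by
    intro y hy
    rw [hder y hy, Lagrange.eval_nodal, norm_prod]
    calc ∏ i ∈ S.erase y, ‖y - id i‖ ≤ ∏ i ∈ S.erase y, 2 * R := by
          refine Finset.prod_le_prod (fun _ _ => norm_nonneg _) fun i hi => ?_
          have h1 := hfR y ((hmem y).1 hy)
          have h2 := hfR i ((hmem i).1 (Finset.mem_of_mem_erase hi))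
          have := norm_sub_le y i
          simp only [id]
          linarith
      _ = (2 * R) ^ (S.erase y).card := by rw [Finset.prod_const]
      _ ≤ (2 * R) ^ f.natDegree :=
          pow_le_pow_right₀ (by linarith) (hcard ▸ Finset.card_erase_le)
  have hnod_le : ∀ y, ‖(Lagrange.nodal (S.erase y) id).coeff j‖ ≤
      R ^ f.natDegree * f.natDegree.choose (f.natDegree / 2) := by
    intro y
    have := Polynomial.coeff_bdd_of_roots_le (B := R) (d := f.natDegree) (RingHom.id ℂ)
      (p := Lagrange.nodal (S.erase y) id) (Lagrange.nodal_monic) (IsAlgClosed.splits _)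
      (by rw [Lagrange.natDegree_nodal, ← hcard]; exact Finset.card_erase_le) ?_ j
    · rwa [Polynomial.map_id, max_eq_left hR] at this
    · intro z hz
      rw [Polynomial.map_id, Polynomial.mem_roots', Polynomial.IsRoot, Lagrange.eval_nodal,
        Finset.prod_eq_zero_iff] at hz
      obtain ⟨-, i, hi, hzi⟩ := hz
      rw [sub_eq_zero.1 hzi]
      exact hfR i ((hmem i).1 (Finset.mem_of_mem_erase hi))
  -- Lagrange interpolation cleared of denominators: both sides have degree below `#S` and agree on
  -- `S`.
  have hid : Polynomial.C D * g = ∑ y ∈ S, Polynomial.C (g.eval y *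
      ∏ w ∈ S.erase y, (Polynomial.derivative f).eval w) * Lagrange.nodal (S.erase y) id := by
    refine Polynomial.eq_of_degrees_lt_of_eval_finset_eq S ?_ ?_ fun y hy => ?_
    · rw [Polynomial.degree_C_mul h0, hcard]
      exact hg
    · refine lt_of_le_of_lt (Polynomial.degree_sum_le _ _) ?_
      refine (Finset.sup_lt_iff (WithBot.bot_lt_coe _)).2 fun y hy => ?_
      rw [← Polynomial.smul_eq_C_mul]
      refine lt_of_le_of_lt (Polynomial.degree_smul_le _ _) ?_
      rw [Lagrange.degree_nodal]
      exact_mod_cast Finset.card_erase_lt_of_mem hy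
    · rw [Polynomial.eval_mul, Polynomial.eval_C, Polynomial.eval_finsetSum,
        Finset.sum_eq_single y, Polynomial.eval_mul, Polynomial.eval_C, ← hder y hy, hDS,
        ← Finset.mul_prod_erase S _ hy]
      · ring
      · intro w hw hwy
        have h1 : (Lagrange.nodal (S.erase w) id).eval y = 0 :=
          Lagrange.eval_nodal_at_node (v := (id : ℂ → ℂ)) (Finset.mem_erase.2 ⟨hwy.symm, hy⟩)
        rw [Polynomial.eval_mul, h1, mul_zero]
      · exact fun h => absurd hy h
  have hcoeff : D * g.coeff j = ∑ y ∈ S, (g.eval y *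
      ∏ w ∈ S.erase y, (Polynomial.derivative f).eval w) *
        (Lagrange.nodal (S.erase y) id).coeff j := by
    have := congrArg (fun p => Polynomial.coeff p j) hid
    simpa only [Polynomial.finsetSum_coeff, Polynomial.coeff_C_mul] using this
  rw [← norm_mul, hcoeff]
  refine (norm_sum_le _ _).trans ?_
  have hterm : ∀ y ∈ S, ‖(g.eval y * ∏ w ∈ S.erase y, (Polynomial.derivative f).eval w) *
        (Lagrange.nodal (S.erase y) id).coeff j‖ ≤
      B * ((2 * R) ^ f.natDegree) ^ f.natDegree *
        (R ^ f.natDegree * f.natDegree.choose (f.natDegree / 2)) := by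
    intro y hy
    rw [norm_mul, norm_mul, norm_prod]
    have hp : ∏ w ∈ S.erase y, ‖(Polynomial.derivative f).eval w‖ ≤
        ((2 * R) ^ f.natDegree) ^ f.natDegree := by
      calc _ ≤ ∏ w ∈ S.erase y, (2 * R) ^ f.natDegree :=
            Finset.prod_le_prod (fun _ _ => norm_nonneg _)
              fun w hw => hder_le w (Finset.mem_of_mem_erase hw)
        _ = ((2 * R) ^ f.natDegree) ^ (S.erase y).card := by rw [Finset.prod_const]
        _ ≤ _ := pow_le_pow_right₀ (one_le_pow₀ (by linarith)) (hcard ▸ Finset.card_erase_le)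
    have := hgB y ((hmem y).1 hy)
    have := hnod_le y
    gcongr
  refine (Finset.sum_le_sum hterm).trans (le_of_eq ?_)
  rw [Finset.sum_const, hcard, nsmul_eq_mul]
  ring

section Monic

variable {M k : ℕ} (ς : Fin k → MvPolynomial (Fin M) ℂ)

/-! ### Reduction modulo the monic polynomial -/

theorem exists_pow_reduction {w : ℕ} (hw : ∀ j : Fin k, (ς j).totalDegree ≤ w * (k - j)) (m : ℕ) :
    ∃ h : Fin k → MvPolynomial (Fin M) ℂ, (∀ j, (h j).totalDegree ≤ w * m) ∧
      ∀ z y, (fibrePoly ς z).eval y = 0 →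
        y ^ m = ∑ j, MvPolynomial.eval z (h j) * y ^ (j : ℕ) := by
  induction m using Nat.strong_induction_on with
  | _ m ih =>
    by_cases hm : m < k
    · refine ⟨Pi.single ⟨m, hm⟩ 1, fun j => ?_, fun z y _ => ?_⟩
      · by_cases hj : j = ⟨m, hm⟩
        · subst hj
          simp
        · simp [Pi.single_eq_of_ne hj]
      · rw [Finset.sum_eq_single ⟨m, hm⟩]
        · simp
        · intro j _ hj
          simp [Pi.single_eq_of_ne hj]
        · simp
    -- Substitute for `y ^ k` in `y ^ (m - k) * y ^ k` and reduce each `y ^ (m - k + i)`; the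
    -- degrees add up to `w (k - i) + w (m - k + i) = w m`.
    · have hlt : ∀ i : Fin k, m - k + i < m := fun i => by have := i.2; omega
      choose H hH hHe using fun i : Fin k => ih (m - k + i) (hlt i)
      refine ⟨fun j => -∑ i, ς i * H i j, fun j => ?_, fun z y hy => ?_⟩
      · rw [MvPolynomial.totalDegree_neg]
        refine MvPolynomial.totalDegree_finsetSum_le fun i _ => ?_
        refine (MvPolynomial.totalDegree_mul _ _).trans ((add_le_add (hw i) (hH i j)).trans ?_)
        rw [← mul_add]
        exact Nat.mul_le_mul_left _ (by have := i.2; omega)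
      · have h1 : y ^ k = -∑ i : Fin k, MvPolynomial.eval z (ς i) * y ^ (i : ℕ) := by
          rw [eval_fibrePoly] at hy
          exact eq_neg_of_add_eq_zero_left hy
        have h2 : y ^ m = y ^ (m - k) * y ^ k := by
          rw [← pow_add, Nat.sub_add_cancel (not_lt.1 hm)]
        rw [h2, h1, mul_neg, Finset.mul_sum]
        simp only [map_neg, map_sum, map_mul, neg_mul, Finset.sum_neg_distrib, Finset.sum_mul]
        rw [Finset.sum_comm]
        refine congrArg _ (Finset.sum_congr rfl fun i _ => ?_)
        rw [mul_left_comm, ← pow_add, hHe i z y hy, Finset.mul_sum]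
        refine Finset.sum_congr rfl fun j _ => ?_
        ring

theorem exists_reduction {w : ℕ} (hw1 : 1 ≤ w)
    (hw : ∀ j : Fin k, (ς j).totalDegree ≤ w * (k - j)) {n : ℕ}
    (P : MvPolynomial (Fin (M + 1)) ℂ) (hP : P.totalDegree ≤ n) :
    ∃ g : Fin k → MvPolynomial (Fin M) ℂ, (∀ j, (g j).totalDegree ≤ w * n) ∧
      ∀ z y, (fibrePoly ς z).eval y = 0 →
        MvPolynomial.eval (Fin.snoc z y : Fin (M + 1) → ℂ) P =
          ∑ j, MvPolynomial.eval z (g j) * y ^ (j : ℕ) := by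
  choose H hH hHe using exists_pow_reduction ς hw
  refine ⟨fun j => ∑ m ∈ Finset.range (n + 1), (lastEquiv M P).coeff m * H m j,
    fun j => ?_, fun z y hy => ?_⟩
  · refine MvPolynomial.totalDegree_finsetSum_le fun m _ => ?_
    by_cases h0 : (lastEquiv M P).coeff m = 0
    · simp [h0]
    · have h1 := totalDegree_coeff_lastEquiv_add_le P m h0
      refine (MvPolynomial.totalDegree_mul _ _).trans ?_
      have h2 := hH m j
      have h3 : n - m ≤ w * (n - m) := Nat.le_mul_of_pos_left _ hw1
      have h4 : w * (n - m) + w * m = w * n := by rw [← mul_add]; congr 1; omega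
      omega
  · rw [eval_eq_eval_lastEquiv, Fin.init_snoc, Fin.snoc_last,
      Polynomial.eval_eq_sum_range' (n := n + 1)]
    · simp only [map_sum, map_mul, Finset.sum_mul, Polynomial.coeff_map]
      rw [Finset.sum_comm]
      refine Finset.sum_congr rfl fun m _ => ?_
      rw [hHe m z y hy, Finset.mul_sum]
      refine Finset.sum_congr rfl fun j _ => ?_
      ring
    · exact Nat.lt_succ_of_le
        (Polynomial.natDegree_map_le.trans ((natDegree_lastEquiv_le P).trans hP))

theorem exists_discPoly_mul_coeff_bound {X : Set (Fin M → ℂ)} (hX : IsCompact X) :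
    ∃ C : ℝ, 0 < C ∧ ∀ z ∈ X, ∀ (c : Fin k → ℂ) (B : ℝ), 0 ≤ B →
      (∀ y, (fibrePoly ς z).eval y = 0 → ‖∑ j, c j * y ^ (j : ℕ)‖ ≤ B) →
        ∀ j, ‖MvPolynomial.eval z (discPoly ς) * c j‖ ≤ C * B := by
  obtain ⟨R, hR1, hR⟩ := exists_norm_le_of_eval_fibrePoly_eq_zero ς hX
  -- The summand `1` keeps the constant positive when `k = 0`.
  refine ⟨k * (((2 * R) ^ k) ^ k * (R ^ k * k.choose (k / 2))) + 1, by positivity,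
    fun z hz c B hB h j => ?_⟩
  set g : Polynomial ℂ := ∑ j : Fin k, Polynomial.C (c j) * Polynomial.X ^ (j : ℕ) with hg
  have hge : ∀ y, g.eval y = ∑ j, c j * y ^ (j : ℕ) := fun y => by
    simp [hg, Polynomial.eval_finsetSum]
  have hgc : g.coeff j = c j := by
    simp [hg, Polynomial.coeff_X_pow, Fin.val_inj]
  have key := norm_resultant_derivative_mul_coeff_le (g := g) (monic_fibrePoly ς z) hR1 (hR z hz)
    (by rw [natDegree_fibrePoly]; exact Polynomial.degree_sum_fin_lt c) hB
    (fun y hy => by rw [hge]; exact h y hy) j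
  rw [← eval_discPoly, hgc, natDegree_fibrePoly, ← norm_mul] at key
  linarith

/-! ### Determining sets on the lifted set -/

/-- When `d = k`, the reduced coefficients of `P` have degree at most `n`. Their products with the
discriminant vanish on `A`, hence on `K`, and `hcancel` removes the discriminant. -/
theorem Determines.liftOver_of_discPoly {A K : Set (Fin M → ℂ)} {l n : ℕ} (h : Determines A K l)
    (hk : 1 ≤ k) (hd : (monicForm ς).totalDegree = k) (hl : n + (k ^ 2 - k) ≤ l)
    (hcancel : ∀ g, (∀ z ∈ K, MvPolynomial.eval z (discPoly ς * g) = 0) →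
      ∀ z ∈ K, MvPolynomial.eval z g = 0) :
    Determines (liftOver (monicForm ς) A) (liftOver (monicForm ς) K) n := by
  intro P hP hPA x hx
  obtain ⟨g, hgd, hg⟩ := exists_reduction ς (one_le_weight ς hk) (totalDegree_le_weight_mul ς) P hP
  have hw : weight (monicForm ς).totalDegree k = 1 := if_pos hd
  have hg0 : ∀ j, ∀ z ∈ K, MvPolynomial.eval z (g j) = 0 := by
    refine fun j => hcancel _ (h _ ?_ fun z hz => ?_)
    · refine (MvPolynomial.totalDegree_mul _ _).trans ?_
      have h1 := hgd j
      rw [hw, one_mul] at h1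
      have h2 := totalDegree_discPoly_le ς hk hd
      omega
    -- With bound `0` on the fibre values, the interpolation estimate becomes a vanishing statement.
    · obtain ⟨C, -, hC⟩ := exists_discPoly_mul_coeff_bound ς (isCompact_singleton (x := z))
      have := hC z rfl (fun j => MvPolynomial.eval z (g j)) 0 le_rfl (fun y hy => ?_) j
      · rw [mul_zero] at this
        rw [map_mul]
        exact norm_le_zero_iff.1 this
      · rw [← hg z y hy, hPA _ ((snoc_mem_liftOver_iff ς).2 ⟨hy, hz⟩), norm_zero]
  rw [mem_liftOver_iff] at hx
  have := hg _ _ hx.1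
  rw [Fin.snoc_init_self] at this
  rw [this]
  exact Finset.sum_eq_zero fun j _ => by rw [hg0 j _ hx.2, zero_mul]

/-! ### Elimination of the last variable -/

/-- Take the resultant of `s` and `q` in `y`. By Gauss's lemma `s` stays irreducible over the
fraction field and does not divide `q`, so the two are coprime and the resultant is nonzero; the
Bézout identity gives `v`. -/
theorem exists_eliminant (hk : 1 ≤ k) (hirr : Irreducible (monicForm ς))
    {q : MvPolynomial (Fin (M + 1)) ℂ}
    (hq : ∃ x, MvPolynomial.eval x (monicForm ς) = 0 ∧ MvPolynomial.eval x q ≠ 0) :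
    ∃ N : MvPolynomial (Fin M) ℂ, N ≠ 0 ∧ ∃ v : MvPolynomial (Fin (M + 1)) ℂ,
      ∀ x, MvPolynomial.eval x (monicForm ς) = 0 →
        MvPolynomial.eval (Fin.init x) N = MvPolynomial.eval x v * MvPolynomial.eval x q := by
  set f := monicFormY ς with hf
  set p := lastEquiv M q with hp
  have hfm : f.Monic := monic_monicFormY ς
  have hfirr : Irreducible f := by
    rw [hf, ← lastEquiv_monicForm]
    exact (MulEquiv.irreducible_iff (lastEquiv M)).2 hirr
  have hndvd : ¬ f ∣ p := by
    rintro ⟨u, hu⟩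
    obtain ⟨x, hx, hqx⟩ := hq
    refine hqx ?_
    rw [eval_eq_eval_lastEquiv, ← hp, hu, Polynomial.map_mul, Polynomial.eval_mul]
    rw [eval_monicForm] at hx
    rw [hf, hx, zero_mul]
  let L := FractionRing (MvPolynomial (Fin M) ℂ)
  have hinj : Function.Injective (algebraMap (MvPolynomial (Fin M) ℂ) L) :=
    IsFractionRing.injective _ _
  have hN : f.resultant p ≠ 0 := by
    intro h0
    have h1 : (f.map (algebraMap _ L)).resultant (p.map (algebraMap _ L)) = 0 := by
      rw [Polynomial.natDegree_map_eq_of_injective hinj,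
        Polynomial.natDegree_map_eq_of_injective hinj, Polynomial.resultant_map_map, h0, map_zero]
    rw [Polynomial.resultant_eq_zero_iff] at h1
    refine h1.2 (((hfm.irreducible_iff_irreducible_map_fraction_map (K := L)).1
      hfirr).coprime_iff_not_dvd.2 fun hdvd => hndvd ?_)
    exact (Polynomial.map_dvd_map _ hinj hfm).1 hdvd
  refine ⟨f.resultant p, hN, ?_⟩
  obtain ⟨u, v, -, -, huv⟩ := Polynomial.exists_mul_add_mul_eq_C_resultant f p le_rfl le_rfl
    (Or.inl (by rw [hf, natDegree_monicFormY]; omega))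
  refine ⟨(lastEquiv M).symm v, fun x hx => ?_⟩
  have h1 := congrArg (fun r : Polynomial (MvPolynomial (Fin M) ℂ) =>
    (r.map (MvPolynomial.eval (Fin.init x))).eval (x (Fin.last M))) huv
  simp only [Polynomial.map_add, Polynomial.map_mul, Polynomial.eval_add, Polynomial.eval_mul,
    Polynomial.map_C, Polynomial.eval_C] at h1
  rw [eval_monicForm] at hx
  rw [← h1, hf, hx, zero_mul, zero_add, eval_eq_eval_lastEquiv, AlgEquiv.apply_symm_apply,
    eval_eq_eval_lastEquiv q, mul_comm]

theorem discPoly_ne_zero_of_nonempty {K : Set (Fin M → ℂ)} (h : (K \ discSet ς).Nonempty) :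
    discPoly ς ≠ 0 := by
  obtain ⟨z, -, hz⟩ := h
  rw [notMem_discSet_iff] at hz
  rintro h0
  exact hz (by rw [h0, map_zero])

/-- Replacing `q` by its eliminant `N(z)` makes `N g` vanish on the lifted set. Interpolation shows
that the discriminant times `N` times each reduced coefficient of `g` vanishes on `K`, and `K` is
determining. This supplies `hcancel` for the second cover. -/
theorem eval_eq_zero_of_mul_eq_zero_on_liftOver (hk : 1 ≤ k) (hirr : Irreducible (monicForm ς))
    {K : Set (Fin M → ℂ)} (hdet : IsPolyDetermining K) (hdisc : discPoly ς ≠ 0)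
    {q : MvPolynomial (Fin (M + 1)) ℂ}
    (hq : ∃ x, MvPolynomial.eval x (monicForm ς) = 0 ∧ MvPolynomial.eval x q ≠ 0)
    (g : MvPolynomial (Fin (M + 1)) ℂ)
    (hg : ∀ x ∈ liftOver (monicForm ς) K, MvPolynomial.eval x (q * g) = 0) :
    ∀ x ∈ liftOver (monicForm ς) K, MvPolynomial.eval x g = 0 := by
  obtain ⟨N, hN, v, hNv⟩ := exists_eliminant ς hk hirr hq
  obtain ⟨c, -, hc⟩ := exists_reduction ς (one_le_weight ς hk) (totalDegree_le_weight_mul ς) g le_rfl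
  have hc0 : ∀ j, c j = 0 := by
    intro j
    have : discPoly ς * (N * c j) = 0 := hdet _ fun z hz => by
      obtain ⟨C, -, hC⟩ := exists_discPoly_mul_coeff_bound ς (isCompact_singleton (x := z))
      have := hC z rfl (fun j => MvPolynomial.eval z (N * c j)) 0 le_rfl (fun y hy => ?_) j
      · rw [mul_zero] at this
        rw [map_mul]
        exact norm_le_zero_iff.1 this
      · have hx := (snoc_mem_liftOver_iff ς (K := K)).2 ⟨hy, hz⟩
        have h1 := hg _ hx
        have h2 := hNv _ hx.1
        rw [Fin.init_snoc] at h2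
        have h3 : ∑ j, MvPolynomial.eval z (N * c j) * y ^ (j : ℕ) =
            MvPolynomial.eval z N * MvPolynomial.eval (Fin.snoc z y : Fin (M + 1) → ℂ) g := by
          rw [hc z y hy, Finset.mul_sum]
          exact Finset.sum_congr rfl fun j _ => by rw [map_mul, mul_assoc]
        rw [h3, h2, mul_assoc, ← map_mul, h1, mul_zero, norm_zero]
    simpa [hdisc, hN] using this
  intro x hx
  rw [mem_liftOver_iff] at hx
  have := hc _ _ hx.1
  rw [Fin.snoc_init_self] at this
  rw [this]
  exact Finset.sum_eq_zero fun j _ => by rw [hc0 j, map_zero, zero_mul]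

end Monic

/-! ### Uniform norms and meshes -/

section Norm

variable {N : ℕ} {K : Set (Fin N → ℂ)}

theorem polyNorm_nonneg (p : MvPolynomial (Fin N) ℂ) : 0 ≤ polyNorm K p :=
  Real.sSup_nonneg (by rintro _ ⟨z, -, rfl⟩; exact norm_nonneg _)

theorem polyNorm_le {p : MvPolynomial (Fin N) ℂ} {B : ℝ} (hB : 0 ≤ B)
    (h : ∀ z ∈ K, ‖MvPolynomial.eval z p‖ ≤ B) : polyNorm K p ≤ B :=
  Real.sSup_le (by rintro _ ⟨z, hz, rfl⟩; exact h z hz) hB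

theorem norm_eval_le_polyNorm (hK : IsCompact K) (p : MvPolynomial (Fin N) ℂ) {z : Fin N → ℂ}
    (hz : z ∈ K) : ‖MvPolynomial.eval z p‖ ≤ polyNorm K p :=
  le_csSup (hK.bddAbove_image (MvPolynomial.continuous_eval p).norm.continuousOn)
    (Set.mem_image_of_mem _ hz)

theorem IsWAM.determines (hK : IsCompact K) {A : ℕ → Set (Fin N → ℂ)} (hA : IsWAM K A) {l : ℕ}
    (hl : 1 ≤ l) : Determines (A l) K l := by
  intro p hp hpA z hz
  obtain ⟨C, hC, -, hCn⟩ := hA.norming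
  have h0 : polyNorm (A l) p ≤ 0 := polyNorm_le le_rfl fun w hw => by rw [hpA w hw, norm_zero]
  have h1 := (norm_eval_le_polyNorm hK p hz).trans (hCn l hl p hp)
  exact norm_le_zero_iff.1 (h1.trans (mul_nonpos_of_nonneg_of_nonpos (hC l hl).le h0))

/-- Extend a linear section of `f` over its range to all of `ι → ℂ`; the vectors `e b` are the
images of the standard basis. -/
theorem exists_sum_smul_section {V ι : Type*} [AddCommGroup V] [Module ℂ V] [Fintype ι]
    (f : V →ₗ[ℂ] (ι → ℂ)) : ∃ e : ι → V, ∀ p, f (∑ b, f p b • e b) = f p := by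
  classical
  obtain ⟨g, hg⟩ := f.rangeRestrict.exists_rightInverse_of_surjective f.range_rangeRestrict
  obtain ⟨φ, hφ⟩ := LinearMap.exists_extend g
  refine ⟨fun b => φ fun j => if b = j then 1 else 0, fun p => ?_⟩
  rw [← LinearMap.pi_apply_eq_sum_univ φ (f p)]
  have h1 : φ (f p) = g (f.rangeRestrict p) := by
    rw [← hφ]
    rfl
  rw [h1]
  exact congrArg Subtype.val (LinearMap.congr_fun hg (f.rangeRestrict p))

/-- Evaluation at the points of `A`, on the polynomials of degree at most `n`. -/
noncomputable def evalOn (n : ℕ) (A : Set (Fin N → ℂ)) :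
    MvPolynomial.restrictTotalDegree (Fin N) ℂ n →ₗ[ℂ] (A → ℂ) :=
  LinearMap.pi fun b => (MvPolynomial.aeval (b : Fin N → ℂ)).toLinearMap ∘ₗ
    (MvPolynomial.restrictTotalDegree (Fin N) ℂ n).subtype

theorem evalOn_apply (n : ℕ) (A : Set (Fin N → ℂ))
    (p : MvPolynomial.restrictTotalDegree (Fin N) ℂ n) (b : A) :
    evalOn n A p b = MvPolynomial.eval (b : Fin N → ℂ) (p : MvPolynomial (Fin N) ℂ) := by
  rw [← MvPolynomial.coe_aeval_eq_eval]
  rfl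

theorem Determines.exists_eval_eq_sum {A : Set (Fin N → ℂ)} [Fintype A] {n : ℕ}
    (h : Determines A K n) :
    ∃ e : A → MvPolynomial (Fin N) ℂ, ∀ p : MvPolynomial (Fin N) ℂ, p.totalDegree ≤ n →
      ∀ z ∈ K, MvPolynomial.eval z p =
        ∑ b : A, MvPolynomial.eval (b : Fin N → ℂ) p * MvPolynomial.eval z (e b) := by
  obtain ⟨e, he⟩ := exists_sum_smul_section (evalOn n A)
  refine ⟨fun b => e b, fun p hp z hz => ?_⟩
  obtain ⟨q, rfl⟩ : ∃ q : MvPolynomial.restrictTotalDegree (Fin N) ℂ n,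
      (q : MvPolynomial (Fin N) ℂ) = p :=
    ⟨⟨p, (MvPolynomial.mem_restrictTotalDegree _ _ _).2 hp⟩, rfl⟩
  have h0 := h _ ((MvPolynomial.mem_restrictTotalDegree _ _ _).1
    (q - ∑ b, evalOn n A q b • e b).2) (fun b hb => by
      rw [← evalOn_apply n A _ ⟨b, hb⟩, map_sub, he, sub_self, Pi.zero_apply]) z hz
  rw [Submodule.coe_sub, map_sub, sub_eq_zero] at h0
  rw [h0, Submodule.coe_sum, map_sum]
  refine Finset.sum_congr rfl fun b _ => ?_
  rw [Submodule.coe_smul, MvPolynomial.smul_eval, evalOn_apply]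

/-- On `K` a polynomial is a fixed combination of its values on `A`, so a Lebesgue-type constant
exists. No control in `n` is claimed; the result serves finitely many `n`. -/
theorem Determines.exists_polyNorm_le (hK : IsCompact K) {A : Set (Fin N → ℂ)} (hA : A.Finite)
    {n : ℕ} (h : Determines A K n) :
    ∃ C : ℝ, 0 < C ∧ ∀ p : MvPolynomial (Fin N) ℂ, p.totalDegree ≤ n →
      polyNorm K p ≤ C * polyNorm A p := by
  have : Fintype A := hA.fintype
  obtain ⟨e, he⟩ := h.exists_eval_eq_sum
  have hS0 : 0 ≤ ∑ b, polyNorm K (e b) := Finset.sum_nonneg fun _ _ => polyNorm_nonneg _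
  refine ⟨∑ b, polyNorm K (e b) + 1, add_pos_of_nonneg_of_pos hS0 one_pos, fun p hp => ?_⟩
  have hA0 : 0 ≤ polyNorm A p := polyNorm_nonneg p
  refine polyNorm_le (mul_nonneg (add_nonneg hS0 zero_le_one) hA0) fun z hz => ?_
  rw [he p hp z hz]
  calc ‖∑ b : A, MvPolynomial.eval (b : Fin N → ℂ) p * MvPolynomial.eval z (e b)‖
      ≤ ∑ b, polyNorm A p * polyNorm K (e b) := by
        refine (norm_sum_le _ _).trans (Finset.sum_le_sum fun b _ => ?_)
        rw [norm_mul]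
        exact mul_le_mul (norm_eval_le_polyNorm hA.isCompact p b.2) (norm_eval_le_polyNorm hK _ hz)
          (norm_nonneg _) hA0
    _ ≤ _ := by
        rw [← Finset.mul_sum, mul_comm]
        exact mul_le_mul_of_nonneg_right (by linarith) hA0

theorem DivisionInequalityWith.polyNorm_le {m : ℝ} (hm : 0 < m) (h : DivisionInequalityWith K m)
    {D : MvPolynomial (Fin N) ℂ} (hD : ∃ z ∈ K, MvPolynomial.eval z D ≠ 0) {W : ℕ} (hW : 1 ≤ W) :
    ∃ (r : ℕ) (Q : ℝ), 0 < Q ∧ ∀ n : ℕ, 1 ≤ n → ∀ p : MvPolynomial (Fin N) ℂ,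
      p.totalDegree ≤ W * n → polyNorm K p ≤ Q * n ^ r * polyNorm K (p * D) := by
  obtain ⟨Q, hQ, hQb⟩ := h D hD
  set δ := D.totalDegree with hδ
  set r := ⌈m * δ⌉₊ with hr
  set U : ℝ := ((W + δ : ℕ) : ℝ) with hU
  have hU1 : 1 ≤ U := by
    rw [hU]
    exact_mod_cast le_trans hW (Nat.le_add_right _ _)
  refine ⟨r, Q * U ^ r, by positivity, fun n hn p hp => ?_⟩
  have hn' : (1 : ℝ) ≤ n := by exact_mod_cast hn
  refine (hQb p).trans (mul_le_mul_of_nonneg_right ?_ (polyNorm_nonneg _))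
  rw [mul_assoc]
  refine mul_le_mul_of_nonneg_left ?_ hQ.le
  have h2 : (p.totalDegree : ℝ) + δ ≤ U * n := by
    have : p.totalDegree + δ ≤ (W + δ) * n := by
      rw [add_mul]
      exact add_le_add hp (Nat.le_mul_of_pos_right _ hn)
    rw [hU]
    exact_mod_cast this
  -- A base of at least `1` permits rounding the real exponent up to `r`.
  have hUn : 1 ≤ U * n := one_le_mul_of_one_le_of_one_le hU1 hn'
  calc (p.totalDegree + δ : ℝ) ^ (m * δ) ≤ (U * n) ^ (m * δ) :=
        Real.rpow_le_rpow (by positivity) h2 (by positivity)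
    _ ≤ (U * n) ^ (r : ℝ) := Real.rpow_le_rpow_of_exponent_le hUn (Nat.le_ceil _)
    _ = U ^ r * n ^ r := by rw [Real.rpow_natCast, mul_pow]

end Norm

/-! ### The lifted mesh -/

section Lift

variable {N k₁ k₂ : ℕ} {ς₁ : Fin k₁ → MvPolynomial (Fin N) ℂ}
  {ς₂ : Fin k₂ → MvPolynomial (Fin (N + 1)) ℂ} {K : Set (Fin N → ℂ)}

theorem liftOver₂_eq (s₁ : MvPolynomial (Fin (N + 1)) ℂ) (s₂ : MvPolynomial (Fin (N + 2)) ℂ)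
    (K : Set (Fin N → ℂ)) : liftOver₂ s₁ s₂ K = liftOver s₂ (liftOver s₁ K) := by
  ext x
  simp only [liftOver₂, liftOver, Set.mem_ofPred_eq]
  tauto

/-- A bound for a polynomial on the lifted set by bounds for its coefficients. -/
theorem exists_norm_eval_le_of_reduction {M k : ℕ} (ς : Fin k → MvPolynomial (Fin M) ℂ)
    (hk : 1 ≤ k) {X : Set (Fin M → ℂ)} (hX : IsCompact X) :
    ∃ C : ℝ, 0 < C ∧ ∀ (P : MvPolynomial (Fin (M + 1)) ℂ) (g : Fin k → MvPolynomial (Fin M) ℂ),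
      (∀ z y, (fibrePoly ς z).eval y = 0 →
        MvPolynomial.eval (Fin.snoc z y : Fin (M + 1) → ℂ) P =
          ∑ j, MvPolynomial.eval z (g j) * y ^ (j : ℕ)) →
      ∀ T : ℝ, 0 ≤ T → (∀ j, ∀ z ∈ X, ‖MvPolynomial.eval z (g j)‖ ≤ T) →
        ∀ x ∈ liftOver (monicForm ς) X, ‖MvPolynomial.eval x P‖ ≤ C * T := by
  obtain ⟨R, hR1, hR⟩ := exists_norm_le_of_eval_fibrePoly_eq_zero ς hX
  have hk' : (0 : ℝ) < k := by exact_mod_cast hk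
  refine ⟨k * R ^ k, by positivity, fun P g hg T hT hgT x hx => ?_⟩
  rw [mem_liftOver_iff] at hx
  have h1 := hg _ _ hx.1
  rw [Fin.snoc_init_self] at h1
  have h2 : ∀ j : Fin k, ‖MvPolynomial.eval (Fin.init x : Fin M → ℂ) (g j) *
      x (Fin.last M) ^ (j : ℕ)‖ ≤ T * R ^ k := fun j => by
    rw [norm_mul, norm_pow]
    refine mul_le_mul (hgT j _ hx.2) ?_ (by positivity) hT
    exact (pow_le_pow_left₀ (norm_nonneg _) (hR _ hx.2 _ hx.1) _).trans
      (pow_le_pow_right₀ hR1 j.2.le)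
  rw [h1]
  refine (norm_sum_le _ _).trans ((Finset.sum_le_sum fun j _ => h2 j).trans (le_of_eq ?_))
  rw [Finset.sum_const, Finset.card_univ, Fintype.card_fin, nsmul_eq_mul]
  ring

variable (ς₁ ς₂) in
/-- A bound for the coefficients of `P` by its values on the fibre, after multiplication by a
fixed polynomial in the base variables. -/
theorem exists_multiplier_bound (hk₁ : 1 ≤ k₁)
    (hirr : Irreducible (monicForm ς₁)) (hK : IsCompact K) (hdisc₁ : discPoly ς₁ ≠ 0)
    (hdisc₂ : ∃ x, MvPolynomial.eval x (monicForm ς₁) = 0 ∧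
      MvPolynomial.eval x (discPoly ς₂) ≠ 0) :
    ∃ D : MvPolynomial (Fin N) ℂ, D ≠ 0 ∧ ∃ C : ℝ, 0 < C ∧
      ∀ (P : MvPolynomial (Fin (N + 2)) ℂ) (g : Fin k₂ → MvPolynomial (Fin (N + 1)) ℂ)
        (c : Fin k₂ → Fin k₁ → MvPolynomial (Fin N) ℂ),
      (∀ z y, (fibrePoly ς₂ z).eval y = 0 →
        MvPolynomial.eval (Fin.snoc z y : Fin (N + 2) → ℂ) P =
          ∑ j, MvPolynomial.eval z (g j) * y ^ (j : ℕ)) →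
      (∀ j, ∀ z y, (fibrePoly ς₁ z).eval y = 0 →
        MvPolynomial.eval (Fin.snoc z y : Fin (N + 1) → ℂ) (g j) =
          ∑ i, MvPolynomial.eval z (c j i) * y ^ (i : ℕ)) →
      ∀ β : ℝ, 0 ≤ β → ∀ A ⊆ K,
        (∀ x ∈ liftOver (monicForm ς₂) (liftOver (monicForm ς₁) A), ‖MvPolynomial.eval x P‖ ≤ β) →
        ∀ j i, ∀ z ∈ A, ‖MvPolynomial.eval z (c j i * D)‖ ≤ C * β := by
  have hF : IsCompact (liftOver (monicForm ς₁) K) := isCompact_liftOver ς₁ hK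
  obtain ⟨E, hE0, v, hEv⟩ := exists_eliminant ς₁ hk₁ hirr hdisc₂
  obtain ⟨C₁, hC₁, hC₁b⟩ := exists_discPoly_mul_coeff_bound ς₁ hK
  obtain ⟨C₂, hC₂, hC₂b⟩ := exists_discPoly_mul_coeff_bound ς₂ hF
  obtain ⟨V, hV0, hV⟩ : ∃ V : ℝ, 0 < V ∧ ∀ x ∈ liftOver (monicForm ς₁) K,
      ‖MvPolynomial.eval x v‖ ≤ V :=
    ⟨polyNorm (liftOver (monicForm ς₁) K) v + 1,
      add_pos_of_nonneg_of_pos (polyNorm_nonneg v) one_pos,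
      fun x hx => (norm_eval_le_polyNorm hF v hx).trans (le_add_of_nonneg_right zero_le_one)⟩
  -- `E` here is the eliminant of the discriminant of `s₂`, with `E = v · disc₂` on `s₁ = 0`. The
  -- factor `disc₂` pays for interpolation in `y₂`, and `discPoly ς₁` for interpolation in `y₁`.
  refine ⟨discPoly ς₁ * E, mul_ne_zero hdisc₁ hE0, C₁ * (V * C₂), by positivity,
    fun P g c hg hc β hβ A hAK hPβ j i z hz => ?_⟩
  have hfib : ∀ y, (fibrePoly ς₁ z).eval y = 0 →
      ‖∑ i, MvPolynomial.eval z (E * c j i) * y ^ (i : ℕ)‖ ≤ V * (C₂ * β) := fun y hy => by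
    have hx := (snoc_mem_liftOver_iff ς₁).2 ⟨hy, hz⟩
    have hxF := (snoc_mem_liftOver_iff ς₁).2 ⟨hy, hAK hz⟩
    have h1 : ∑ i, MvPolynomial.eval z (E * c j i) * y ^ (i : ℕ) =
        MvPolynomial.eval (Fin.snoc z y : Fin (N + 1) → ℂ) v *
          (MvPolynomial.eval (Fin.snoc z y : Fin (N + 1) → ℂ) (discPoly ς₂) *
            MvPolynomial.eval (Fin.snoc z y : Fin (N + 1) → ℂ) (g j)) := by
      have h2 := hEv _ hx.1
      rw [Fin.init_snoc] at h2
      rw [← mul_assoc, ← h2, hc j z y hy, Finset.mul_sum]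
      exact Finset.sum_congr rfl fun i _ => by rw [map_mul, mul_assoc]
    have h3 := hC₂b _ hxF
      (fun j => MvPolynomial.eval (Fin.snoc z y : Fin (N + 1) → ℂ) (g j)) β hβ (fun y₂ hy₂ => by
        rw [← hg _ y₂ hy₂]
        exact hPβ _ ((snoc_mem_liftOver_iff ς₂).2 ⟨hy₂, hx⟩)) j
    rw [h1, norm_mul]
    exact mul_le_mul (hV _ hxF) h3 (norm_nonneg _) hV0.le
  have h4 := hC₁b z (hAK hz) (fun i => MvPolynomial.eval z (E * c j i)) (V * (C₂ * β))
    (by positivity) hfib i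
  have e : c j i * (discPoly ς₁ * E) = discPoly ς₁ * (E * c j i) := by ring
  rw [e, map_mul]
  refine h4.trans (le_of_eq ?_)
  ring

/-- The constants `n₀`, `r`, `c` depend neither on `n` nor on the mesh `A`, which makes the growth
polynomial. The offset `n₀` is the degree of the multiplier `D`. -/
theorem exists_polyNorm_liftOver_le (hk₁ : 1 ≤ k₁) (hk₂ : 1 ≤ k₂)
    (hirr : Irreducible (monicForm ς₁)) (hK : IsCompact K) (hdet : IsPolyDetermining K)
    (hdiv : SatisfiesDivisionInequality K) (hdisc₁ : discPoly ς₁ ≠ 0)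
    (hdisc₂ : ∃ x, MvPolynomial.eval x (monicForm ς₁) = 0 ∧
      MvPolynomial.eval x (discPoly ς₂) ≠ 0) :
    ∃ (n₀ r : ℕ) (c : ℝ), 0 < c ∧ ∀ n, 1 ≤ n → ∀ (A : Set (Fin N → ℂ)) (a : ℝ), A ⊆ K → 0 ≤ a →
      (∀ p : MvPolynomial (Fin N) ℂ, p.totalDegree ≤
        weight (monicForm ς₁).totalDegree k₁ * (weight (monicForm ς₂).totalDegree k₂ * n) + n₀ →
          polyNorm K p ≤ a * polyNorm A p) →
      ∀ (P : MvPolynomial (Fin (N + 2)) ℂ) (β : ℝ), P.totalDegree ≤ n → 0 ≤ β →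
        (∀ x ∈ liftOver (monicForm ς₂) (liftOver (monicForm ς₁) A), ‖MvPolynomial.eval x P‖ ≤ β) →
        polyNorm (liftOver (monicForm ς₂) (liftOver (monicForm ς₁) K)) P ≤ c * n ^ r * a * β := by
  have hw₁ := one_le_weight ς₁ hk₁
  have hw₂ := one_le_weight ς₂ hk₂
  obtain ⟨D, hD0, C, hC0, hC⟩ := exists_multiplier_bound ς₁ ς₂ hk₁ hirr hK hdisc₁ hdisc₂
  obtain ⟨m, hm, hdivm⟩ := hdiv
  obtain ⟨r, Q, hQ, hQb⟩ := hdivm.polyNorm_le hm (D := D)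
    (by by_contra! h; exact hD0 (hdet _ h)) (Nat.mul_pos hw₁ hw₂)
  obtain ⟨C₁, hC₁, hC₁b⟩ := exists_norm_eval_le_of_reduction ς₁ hk₁ hK
  obtain ⟨C₂, hC₂, hC₂b⟩ := exists_norm_eval_le_of_reduction ς₂ hk₂ (isCompact_liftOver ς₁ hK)
  refine ⟨D.totalDegree, r, C₂ * (C₁ * (Q * C)), by positivity,
    fun n hn A a hAK ha hAa P β hP hβ hPβ => ?_⟩
  obtain ⟨g, hgd, hg⟩ := exists_reduction ς₂ hw₂ (totalDegree_le_weight_mul ς₂) P hP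
  choose c hcd hc using fun j => exists_reduction ς₁ hw₁ (totalDegree_le_weight_mul ς₁) (g j) (hgd j)
  have hcK : ∀ j i, polyNorm K (c j i) ≤ Q * n ^ r * (a * (C * β)) := fun j i => by
    have h1 : polyNorm A (c j i * D) ≤ C * β :=
      polyNorm_le (by positivity) (hC P g c hg hc β hβ A hAK hPβ j i)
    have h2 : polyNorm K (c j i * D) ≤ a * (C * β) :=
      (hAa _ ((MvPolynomial.totalDegree_mul _ _).trans
        (Nat.add_le_add_right (hcd j i) _))).trans (mul_le_mul_of_nonneg_left h1 ha)
    refine (hQb n hn _ ((hcd j i).trans (by rw [mul_assoc]))).trans ?_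
    exact mul_le_mul_of_nonneg_left h2 (by positivity)
  have hgF : ∀ j, ∀ x ∈ liftOver (monicForm ς₁) K,
      ‖MvPolynomial.eval x (g j)‖ ≤ C₁ * (Q * n ^ r * (a * (C * β))) := fun j =>
    hC₁b (g j) (c j) (hc j) _ (by positivity) fun i z hz =>
      (norm_eval_le_polyNorm hK _ hz).trans (hcK j i)
  refine polyNorm_le (by positivity) fun x hx => ?_
  refine (hC₂b P g hg _ (by positivity) hgF x hx).trans (le_of_eq ?_)
  ring

end Lift

/-! ### Polynomial growth -/

theorem PolynomialGrowth.comp_le {u : ℕ → ℝ} (hu : PolynomialGrowth u) {l : ℕ → ℕ} {c : ℕ}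
    (hl : ∀ n, 1 ≤ n → n ≤ l n ∧ l n ≤ c * n) : PolynomialGrowth fun n => u (l n) := by
  obtain ⟨r, hr⟩ := hu
  have hev : ∀ᶠ n : ℕ in Filter.atTop, n ≤ l n ∧ l n ≤ c * n :=
    (Filter.eventually_ge_atTop 1).mono hl
  have ht : Filter.Tendsto l Filter.atTop Filter.atTop :=
    Filter.tendsto_atTop_mono' _ (hev.mono fun n h => h.1) Filter.tendsto_id
  refine ⟨r, (hr.comp_tendsto ht).trans (Asymptotics.IsBigO.of_bound ((c : ℝ) ^ r) ?_)⟩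
  filter_upwards [hev] with n hn
  simp only [Function.comp_apply, norm_pow, RCLike.norm_natCast]
  rw [← mul_pow]
  exact pow_le_pow_left₀ (by positivity) (by exact_mod_cast hn.2) r

theorem PolynomialGrowth.mono {u v : ℕ → ℝ} (hv : PolynomialGrowth v) (n₀ : ℕ)
    (h : ∀ n, n₀ ≤ n → 0 ≤ u n ∧ u n ≤ v n) : PolynomialGrowth u := by
  obtain ⟨r, hr⟩ := hv
  refine ⟨r, (Asymptotics.IsBigO.of_bound 1 ?_).trans hr⟩
  filter_upwards [Filter.eventually_ge_atTop n₀] with n hn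
  obtain ⟨h1, h2⟩ := h n hn
  rw [one_mul, Real.norm_of_nonneg h1, Real.norm_of_nonneg (h1.trans h2)]
  exact h2

theorem PolynomialGrowth.const_mul_pow_mul {u : ℕ → ℝ} (hu : PolynomialGrowth u) (c : ℝ) (s : ℕ) :
    PolynomialGrowth fun n => c * (n : ℝ) ^ s * u n := by
  obtain ⟨r, hr⟩ := hu
  refine ⟨s + r, ?_⟩
  simp only [pow_add]
  exact ((Asymptotics.isBigO_refl _ _).const_mul_left c).mul hr

theorem PolynomialGrowth.add_const {u : ℕ → ℝ} (hu : PolynomialGrowth u) (c : ℝ) :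
    PolynomialGrowth fun n => u n + c := by
  obtain ⟨r, hr⟩ := hu
  refine ⟨r, hr.add (Asymptotics.IsBigO.of_bound ‖c‖ ?_)⟩
  filter_upwards [Filter.eventually_ge_atTop 1] with n hn
  have h1 : (1 : ℝ) ≤ (n : ℝ) ^ r := one_le_pow₀ (by exact_mod_cast hn)
  rw [Real.norm_of_nonneg (zero_le_one.trans h1)]
  exact le_mul_of_one_le_right (norm_nonneg c) h1

theorem IsWAM.congr {N : ℕ} {K : Set (Fin N → ℂ)} {A B : ℕ → Set (Fin N → ℂ)} (hA : IsWAM K A)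
    (h : ∀ n, 1 ≤ n → A n = B n) : IsWAM K B := by
  refine ⟨fun n hn => h n hn ▸ hA.subset n hn, fun n hn => h n hn ▸ hA.finite n hn, ?_,
    hA.card_growth.mono 1 fun n hn => ⟨by positivity, by rw [h n hn]⟩⟩
  obtain ⟨C, hC0, hCg, hC⟩ := hA.norming
  exact ⟨C, hC0, hCg, fun n hn => h n hn ▸ hC n hn⟩

/-! ### The mesh index -/

theorem four_mul_weight_le_meshIndex (d₁ k₁ d₂ k₂ n : ℕ) :
    4 * (weight d₁ k₁ * (weight d₂ k₂ * n)) ≤ meshIndex d₁ k₁ d₂ k₂ n := by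
  unfold weight meshIndex
  split_ifs <;> simp only [one_mul, ← mul_assoc] <;> omega

theorem exists_meshIndex_le (d₁ k₁ d₂ k₂ : ℕ) :
    ∃ c, ∀ n, 1 ≤ n → meshIndex d₁ k₁ d₂ k₂ n ≤ c * n := by
  -- In each case the index is affine in `n` with nonnegative coefficients, so it is at most `n`
  -- times its value at `1`.
  refine ⟨meshIndex d₁ k₁ d₂ k₂ 1, fun n hn => ?_⟩
  have h : ∀ m, m ≤ m * n := fun m => Nat.le_mul_of_pos_right m hn
  unfold meshIndex
  split_ifs <;> simp only [mul_one, add_mul]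
  · exact add_le_add (add_le_add le_rfl (h _)) (h _)
  · exact add_le_add le_rfl (h _)
  · exact add_le_add le_rfl (h _)
  · exact le_rfl

/-! ### Assembly of the lifted mesh -/

section Lift

variable {N k₁ k₂ : ℕ} {ς₁ : Fin k₁ → MvPolynomial (Fin N) ℂ}
  {ς₂ : Fin k₂ → MvPolynomial (Fin (N + 1)) ℂ} {K : Set (Fin N → ℂ)}

/-- Each level uses the discriminant if `d = k` and the fibre norm otherwise. The intermediate
degree on the first cover is `n + (k₂² - k₂)` or `d₂ n`, and each branch of the index leaves room
for it. -/
theorem Determines.liftOver_liftOver (hk₁ : 1 ≤ k₁) (hk₂ : 1 ≤ k₂)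
    (hirr : Irreducible (monicForm ς₁)) (hdet : IsPolyDetermining K) (hdisc₁ : discPoly ς₁ ≠ 0)
    (hdisc₂ : ∃ x, MvPolynomial.eval x (monicForm ς₁) = 0 ∧
      MvPolynomial.eval x (discPoly ς₂) ≠ 0) {A : Set (Fin N → ℂ)} {n : ℕ}
    (h : Determines A K
      (meshIndex (monicForm ς₁).totalDegree k₁ (monicForm ς₂).totalDegree k₂ n)) :
    Determines (liftOver (monicForm ς₂) (liftOver (monicForm ς₁) A))
      (liftOver (monicForm ς₂) (liftOver (monicForm ς₁) K)) n := by
  have hc₁ : ∀ g, (∀ z ∈ K, MvPolynomial.eval z (discPoly ς₁ * g) = 0) →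
      ∀ z ∈ K, MvPolynomial.eval z g = 0 := fun g hg z _ => by
    rw [(mul_eq_zero.1 (hdet _ hg)).resolve_left hdisc₁, map_zero]
  have hc₂ := eval_eq_zero_of_mul_eq_zero_on_liftOver ς₁ hk₁ hirr hdet hdisc₁ hdisc₂
  unfold meshIndex at h
  split_ifs at h with h₁ h₂ h₂
  · exact (h.liftOver_of_discPoly ς₁ (n := n + (k₂ ^ 2 - k₂)) hk₁ h₁ (by omega)
      hc₁).liftOver_of_discPoly ς₂ hk₂ h₂ le_rfl hc₂
  · exact (h.liftOver_of_discPoly ς₁ (n := (monicForm ς₂).totalDegree * n) hk₁ h₁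
      (by rw [mul_assoc]; omega) hc₁).liftOver_of_totalDegree_mul_le ς₂ le_rfl
  · exact (h.liftOver_of_totalDegree_mul_le ς₁ (n := n + (k₂ ^ 2 - k₂))
      (by rw [mul_add, mul_assoc 4, mul_assoc 4]; omega)).liftOver_of_discPoly ς₂ hk₂ h₂ le_rfl hc₂
  · exact (h.liftOver_of_totalDegree_mul_le ς₁ (n := (monicForm ς₂).totalDegree * n)
      (by rw [mul_assoc, mul_assoc]; omega)).liftOver_of_totalDegree_mul_le ς₂ le_rfl

theorem setOf_mem_liftOver₂ (s₁ : MvPolynomial (Fin (N + 1)) ℂ) (s₂ : MvPolynomial (Fin (N + 2)) ℂ)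
    {X : Set (Fin N → ℂ)} (hX : X ⊆ K) :
    {x | x ∈ liftOver₂ s₁ s₂ K ∧ Fin.init (Fin.init x) ∈ X} = liftOver s₂ (liftOver s₁ X) := by
  ext x
  simp only [liftOver₂, liftOver, Set.mem_ofPred_eq]
  exact ⟨fun h => ⟨h.1.2.1, h.1.1, h.2⟩, fun h => ⟨⟨h.2.1, h.1, hX h.2.2⟩, h.2.2⟩⟩

theorem liftOver_mono {M : ℕ} (s : MvPolynomial (Fin (M + 1)) ℂ) {X Y : Set (Fin M → ℂ)}
    (h : X ⊆ Y) : liftOver s X ⊆ liftOver s Y := fun _ hx => ⟨hx.1, h hx.2⟩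

theorem finite_liftOver_liftOver {X : Set (Fin N → ℂ)} (hX : X.Finite) :
    (liftOver (monicForm ς₂) (liftOver (monicForm ς₁) X)).Finite :=
  (finite_liftOver ς₂ (finite_liftOver ς₁ hX).1).1

theorem ncard_liftOver_liftOver_le {X : Set (Fin N → ℂ)} (hX : X.Finite) :
    (liftOver (monicForm ς₂) (liftOver (monicForm ς₁) X)).ncard ≤ X.ncard * k₁ * k₂ :=
  (finite_liftOver ς₂ (finite_liftOver ς₁ hX).1).2.trans
    (Nat.mul_le_mul_right _ (finite_liftOver ς₁ hX).2)

theorem isWAM_liftOver (hk₁ : 1 ≤ k₁) (hk₂ : 1 ≤ k₂) (hirr : Irreducible (monicForm ς₁))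
    (hK : IsCompact K) {A : ℕ → Set (Fin N → ℂ)} (hA : IsWAM K A) (hdet : IsPolyDetermining K)
    (hdiv : SatisfiesDivisionInequality K) (hdisc₁ : discPoly ς₁ ≠ 0)
    (hdisc₂ : ∃ x, MvPolynomial.eval x (monicForm ς₁) = 0 ∧
      MvPolynomial.eval x (discPoly ς₂) ≠ 0) {S : Set (Fin N → ℂ)} (hS : S.Finite) (hSK : S ⊆ K) :
    IsWAM (liftOver (monicForm ς₂) (liftOver (monicForm ς₁) K)) fun n =>
      liftOver (monicForm ς₂) (liftOver (monicForm ς₁)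
        (A (meshIndex (monicForm ς₁).totalDegree k₁ (monicForm ς₂).totalDegree k₂ n) ∪ S)) := by
  set l := meshIndex (monicForm ς₁).totalDegree k₁ (monicForm ς₂).totalDegree k₂ with hldef
  obtain ⟨c₀, hc₀⟩ :=
    exists_meshIndex_le (monicForm ς₁).totalDegree k₁ (monicForm ς₂).totalDegree k₂
  have hlw : ∀ n, 4 * (weight (monicForm ς₁).totalDegree k₁ *
      (weight (monicForm ς₂).totalDegree k₂ * n)) ≤ l n := four_mul_weight_le_meshIndex _ _ _ _
  have hwn : ∀ n, n ≤ weight (monicForm ς₁).totalDegree k₁ *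
      (weight (monicForm ς₂).totalDegree k₂ * n) := fun n =>
    (Nat.le_mul_of_pos_left n (one_le_weight ς₂ hk₂)).trans
      (Nat.le_mul_of_pos_left _ (one_le_weight ς₁ hk₁))
  have hl : ∀ n, 1 ≤ n → n ≤ l n ∧ l n ≤ c₀ * n := fun n hn =>
    ⟨by have := hlw n; have := hwn n; omega, hc₀ n hn⟩
  have hl1 : ∀ n, 1 ≤ n → 1 ≤ l n := fun n hn => hn.trans (hl n hn).1
  have hsub : ∀ n, 1 ≤ n → A (l n) ∪ S ⊆ K := fun n hn =>
    Set.union_subset (hA.subset _ (hl1 n hn)) hSK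
  have hfin : ∀ n, 1 ≤ n → (A (l n) ∪ S).Finite := fun n hn => (hA.finite _ (hl1 n hn)).union hS
  have hE : IsCompact (liftOver (monicForm ς₂) (liftOver (monicForm ς₁) K)) :=
    isCompact_liftOver ς₂ (isCompact_liftOver ς₁ hK)
  refine ⟨fun n hn => liftOver_mono _ (liftOver_mono _ (hsub n hn)),
    fun n hn => finite_liftOver_liftOver (hfin n hn), ?_, ?_⟩
  · obtain ⟨C, hC0, hCg, hC⟩ := hA.norming
    obtain ⟨n₀, r, c, hc, hcb⟩ :=
      exists_polyNorm_liftOver_le hk₁ hk₂ hirr hK hdet hdiv hdisc₁ hdisc₂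
    -- These constants serve only `n < n₀`, so they do not affect the growth.
    have hsmall : ∀ n, ∃ b : ℝ, 1 ≤ n → 0 < b ∧ ∀ P : MvPolynomial (Fin (N + 2)) ℂ,
        P.totalDegree ≤ n →
          polyNorm (liftOver (monicForm ς₂) (liftOver (monicForm ς₁) K)) P ≤
            b * polyNorm (liftOver (monicForm ς₂) (liftOver (monicForm ς₁) (A (l n) ∪ S))) P := by
      intro n
      by_cases hn : 1 ≤ n
      · have hd : Determines (A (l n) ∪ S) K (l n) := fun p hp hpA =>
          hA.determines hK (hl1 n hn) p hp fun z hz => hpA z (Or.inl hz)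
        obtain ⟨b, hb⟩ := (hd.liftOver_liftOver hk₁ hk₂ hirr hdet hdisc₁
          hdisc₂).exists_polyNorm_le hE (finite_liftOver_liftOver (hfin n hn))
        exact ⟨b, fun _ => hb⟩
      · exact ⟨0, fun h => absurd h hn⟩
    choose b hb using hsmall
    refine ⟨fun n => if n₀ ≤ n then c * n ^ r * C (l n) else b n, fun n hn => ?_, ?_,
      fun n hn P hP => ?_⟩
    · have h1 := hC0 _ (hl1 n hn)
      have h2 : (0 : ℝ) < n := by exact_mod_cast hn
      have h3 := (hb n hn).1
      dsimp only
      split_ifs <;> positivity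
    -- The threshold `n₀ + 1` ensures `n ≥ 1` even when `n₀ = 0`.
    · refine PolynomialGrowth.mono ((hCg.comp_le hl).const_mul_pow_mul c r) (n₀ + 1) fun n hn => ?_
      rw [if_pos (by omega)]
      have h1 := hC0 _ (hl1 n (by omega))
      exact ⟨by positivity, le_rfl⟩
    · dsimp only
      split_ifs with h
      · refine hcb n hn (A (l n)) (C (l n)) (hA.subset _ (hl1 n hn)) (hC0 _ (hl1 n hn)).le
          (fun p hp => hC _ (hl1 n hn) p (hp.trans ?_)) P _ hP (polyNorm_nonneg P) fun x hx => ?_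
        -- From `n₀ ≤ n ≤ w₁ w₂ n` follows `w₁ w₂ n + n₀ ≤ 2 w₁ w₂ n ≤ l n`.
        · have := hlw n
          have := hwn n
          omega
        · exact norm_eval_le_polyNorm (finite_liftOver_liftOver (hfin n hn)).isCompact P
            (liftOver_mono _ (liftOver_mono _ Set.subset_union_left) hx)
      · exact (hb n hn).2 P hP
  · refine PolynomialGrowth.mono
      (((hA.card_growth.comp_le hl).add_const S.ncard).const_mul_pow_mul (k₁ * k₂) 0) 1
      fun n hn => ⟨by positivity, ?_⟩
    have h1 := ncard_liftOver_liftOver_le (ς₁ := ς₁) (ς₂ := ς₂) (hfin n hn)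
    have h2 := Set.ncard_union_le (A (l n)) S
    rw [pow_zero, mul_one, mul_comm, ← mul_assoc]
    exact_mod_cast h1.trans (Nat.mul_le_mul_right _ (Nat.mul_le_mul_right _ h2))

end Lift

end PolyMesh

theorem mainTheorem3 {N k₁ k₂ : ℕ} (hk₁ : 1 ≤ k₁) (hk₂ : 1 ≤ k₂)
    (ς₁ : Fin k₁ → MvPolynomial (Fin N) ℂ) (ς₂ : Fin k₂ → MvPolynomial (Fin (N + 1)) ℂ)
    (s₁ : MvPolynomial (Fin (N + 1)) ℂ) (hs₁ : s₁ = PolyMesh.monicForm ς₁)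
    (s₂ : MvPolynomial (Fin (N + 2)) ℂ) (hs₂ : s₂ = PolyMesh.monicForm ς₂)
    (hirr : Irreducible s₁)
    (K : Set (Fin N → ℂ)) (hK : IsCompact K)
    (A : ℕ → Set (Fin N → ℂ)) (hA : PolyMesh.IsWAM K A)
    (hdet : PolyMesh.IsPolyDetermining K)
    (hdiv : PolyMesh.SatisfiesDivisionInequality K)
    (F : Set (Fin (N + 1) → ℂ)) (hF : F = PolyMesh.liftOver s₁ K)
    (hKs₁ : (K \ PolyMesh.discSet ς₁).Nonempty)
    (hFs₂ : (F \ PolyMesh.discSet ς₂).Nonempty)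
    (E : Set (Fin (N + 2) → ℂ)) (hE : E = PolyMesh.liftOver₂ s₁ s₂ K) :
    IsCompact E ∧
      ∀ a ∈ K \ PolyMesh.discSet ς₁, ∀ b ∈ Fin.init '' (F \ PolyMesh.discSet ς₂),
        PolyMesh.IsWAM E (fun n =>
          {x | x ∈ E ∧ Fin.init (Fin.init x) ∈
            A (PolyMesh.meshIndex s₁.totalDegree k₁ s₂.totalDegree k₂ n) ∪ {a, b}}) := by
  subst hs₁ hs₂ hF hE
  have hdisc₂ : ∃ x, MvPolynomial.eval x (PolyMesh.monicForm ς₁) = 0 ∧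
      MvPolynomial.eval x (PolyMesh.discPoly ς₂) ≠ 0 := by
    obtain ⟨x, hx, hxd⟩ := hFs₂
    exact ⟨x, hx.1, (PolyMesh.notMem_discSet_iff ς₂).1 hxd⟩
  refine ⟨?_, ?_⟩
  · rw [PolyMesh.liftOver₂_eq]
    exact PolyMesh.isCompact_liftOver ς₂ (PolyMesh.isCompact_liftOver ς₁ hK)
  rintro a ⟨ha, -⟩ b ⟨y, ⟨hy, -⟩, rfl⟩
  have hSK : {a, Fin.init y} ⊆ K := by
    rintro z (rfl | rfl)
    · exact ha
    · exact hy.2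
  have hwam := PolyMesh.isWAM_liftOver (ς₂ := ς₂) hk₁ hk₂ hirr hK hA hdet hdiv
    (PolyMesh.discPoly_ne_zero_of_nonempty ς₁ hKs₁) hdisc₂ (Set.toFinite {a, Fin.init y}) hSK
  rw [← PolyMesh.liftOver₂_eq] at hwam
  -- The two descriptions of the mesh are matched only for `n ≥ 1`: the inclusion of the base mesh
  -- in `K` is available only for indices at least `1`.
  refine hwam.congr fun n hn => (PolyMesh.setOf_mem_liftOver₂ _ _ (Set.union_subset ?_ hSK)).symm
  refine hA.subset _ (hn.trans ?_)
  have h1 := PolyMesh.four_mul_weight_le_meshIndex (PolyMesh.monicForm ς₁).totalDegree k₁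
    (PolyMesh.monicForm ς₂).totalDegree k₂ n
  have h2 := Nat.le_mul_of_pos_left n (PolyMesh.one_le_weight ς₂ hk₂)
  have h3 := Nat.le_mul_of_pos_left (PolyMesh.weight (PolyMesh.monicForm ς₂).totalDegree k₂ * n)
    (PolyMesh.one_le_weight ς₁ hk₁)
  omega
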